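/- For $d\ge 0$ let $\mathcal S$ be the vector space of real symmetric $d\times d$ matrices, $\mathcal D\subset\mathcal S$ the subspace of diagonal matrices, and $\mathcal S_0\subset\mathcal S$, $\mathcal D_0=\mathcal D\cap\mathcal S_0$ the subspaces of matrices of trace zero. Let $\mathcal E$ be a Euclidean space (a finite-dimensional real inner product space) and let $n,N\ge 0$ be integers. A function $F$ on a direct sum $A\oplus B$ of finite-dimensional real vector spaces is called $C^{n,N}$ if the iterated partial derivatives $D_a^{\alpha}D_b^{\beta}F$ (derivatives in directions of $B$ taken first, then in directions of $A$) exist and are continuous on $A\oplus B$ for all orders $|\alpha|\le n$ in $A$ and $|\beta|\le N$ in $B$. A function $F$ on $\mathcal S\oplus\mathcal E$ or on $\mathcal S_0\oplus\mathcal E$ is called rotation-invariant in the first variable if $F(gxg^{-1},v)=F(x,v)$ for all $x$, all $v\in\mathcal E$ and all rotation matrices $g\in SO(d)$. (a) If $F:\mathcal S\oplus\mathcal E\to\mathbf R$ is rotation-invariant in the first variable and the restriction of $F$ to $\mathcal D\oplus\mathcal E$ is $C^{n,N}$, then $F$ is $C^{n,N}$ on $\mathcal S\oplus\mathcal E$.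 (b) If $F:\mathcal S_0\oplus\mathcal E\to\mathbf R$ is rotation-invariant in the first variable and the restriction of $F$ to $\mathcal D_0\oplus\mathcal E$ is $C^{n,N}$, then $F$ is $C^{n,N}$ on $\mathcal S_0\oplus\mathcal E$. -/

import Mathlib

namespace MatrixFunctions

/-- The space `𝒮` of real symmetric `d × d` matrices. -/
def symmMat (d : ℕ) : Submodule ℝ (Matrix (Fin d) (Fin d) ℝ) where
  carrier := {x | x.IsSymm}
  add_mem' := fun hx hy => hx.add hy
  zero_mem' := Matrix.isSymm_zero
  smul_mem' := fun c _ hx => hx.smul c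

/-- The space `𝒟` of real diagonal `d × d` matrices. -/
def diagMat (d : ℕ) : Submodule ℝ (Matrix (Fin d) (Fin d) ℝ) where
  carrier := {x | x.IsDiag}
  add_mem' := fun hx hy => hx.add hy
  zero_mem' := Matrix.isDiag_zero
  smul_mem' := fun c _ hx => hx.smul c

/-- The space `𝒮₀` of real symmetric `d × d` matrices of trace zero. -/
def symmMat₀ (d : ℕ) : Submodule ℝ (Matrix (Fin d) (Fin d) ℝ) :=
  symmMat d ⊓ LinearMap.ker (Matrix.traceLinearMap (Fin d) ℝ ℝ)

/-- The space `𝒟₀ = 𝒟 ∩ 𝒮₀` of real diagonal `d × d` matrices of trace zero. -/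
def diagMat₀ (d : ℕ) : Submodule ℝ (Matrix (Fin d) (Fin d) ℝ) :=
  diagMat d ⊓ symmMat₀ d

theorem diagMat_le_symmMat (d : ℕ) : diagMat d ≤ symmMat d :=
  fun _ hx => Matrix.IsDiag.isSymm hx

theorem diagMat₀_le_symmMat₀ (d : ℕ) : diagMat₀ d ≤ symmMat₀ d :=
  inf_le_right

/-- A function on `V ⊕ E`, with `V` a space of matrices, is rotation-invariant in the first
variable if `F (g x g⁻¹, v) = F (x, v)` for all `x ∈ V`, all `v ∈ E` and all rotation matrices `g`
(orthogonal of determinant one) for which `g x g⁻¹ ∈ V`. The spaces `symmMat d` and `symmMat₀ d`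
are stable under conjugation by rotations, so the last condition is no restriction there. -/
def RotationInvariant {d : ℕ} {E : Type*} (V : Submodule ℝ (Matrix (Fin d) (Fin d) ℝ))
    (F : V × E → ℝ) : Prop :=
  ∀ g ∈ Matrix.specialOrthogonalGroup (Fin d) ℝ, ∀ x y : V,
    (y : Matrix (Fin d) (Fin d) ℝ) = g * (x : Matrix (Fin d) (Fin d) ℝ) * g⁻¹ →
      ∀ v : E, F (y, v) = F (x, v)

/-- The restriction of a function on `V ⊕ E` to `W ⊕ E`, for a subspace `W` of `V`. -/
def restrictFst {M E : Type*} [AddCommGroup M] [Module ℝ M] {W V : Submodule ℝ M} (h : W ≤ V)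
    (F : V × E → ℝ) : W × E → ℝ :=
  fun p => F (Submodule.inclusion h p.1, p.2)

section Regularity

variable {A B : Type*} [AddCommGroup A] [Module ℝ A] [TopologicalSpace A]
  [AddCommGroup B] [Module ℝ B] [TopologicalSpace B]

/-- All iterated partial derivatives `D_{a₁} ⋯ D_{aₖ} F`, `k ≤ n`, in directions `aᵢ` of the first
summand `A` exist everywhere and are continuous on `A ⊕ B` (jointly in both variables). -/
def IsCFst : ℕ → (A × B → ℝ) → Prop
  | 0, F => Continuous F
  | n + 1, F => Continuous F ∧ ∀ a : A,
      (∀ p : A × B, LineDifferentiableAt ℝ F p (a, 0)) ∧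
        IsCFst n (fun p => lineDeriv ℝ F p (a, 0))

/-- `F` is `C^{n,N}` on `A ⊕ B`: all mixed partial derivatives
`D_{a₁} ⋯ D_{aₖ} D_{b₁} ⋯ D_{bₗ} F` with `k ≤ n` directions in `A` and `l ≤ N` directions in `B`
exist everywhere and are continuous on `A ⊕ B`. -/
def IsCnN (n : ℕ) : ℕ → (A × B → ℝ) → Prop
  | 0, F => IsCFst n F
  | N + 1, F => IsCFst n F ∧ ∀ b : B,
      (∀ p : A × B, LineDifferentiableAt ℝ F p (0, b)) ∧
        IsCnN n N (fun p => lineDeriv ℝ F p (0, b))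

end Regularity

end MatrixFunctions

namespace MatrixFunctions

open Filter Topology Set

/-! ### Directional derivatives, partial derivatives and sup-norm estimates -/

section Calculus

variable {V W Y : Type*} [NormedAddCommGroup V] [NormedSpace ℝ V]
  [NormedAddCommGroup W] [NormedSpace ℝ W] [NormedAddCommGroup Y] [NormedSpace ℝ Y]

/-! Differentiation along `E` preserves rotation invariance and commutes with restriction to the
diagonal, so induction on `N` leaves regularity in the matrix variable only. There, class `C^n` with
jointly continuous derivatives means being a `C^n` map into the continuous functions on each closed
ball of `E` (`IsCFst.contDiffFst`, `ContDiffFst.isCFst`). Rotations act on symmetric matrices with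
the same orbits as orthogonal matrices, because a reflection in an eigenvector of `x` commutes with
`x`. Functions are pulled back to all square matrices by the symmetric part or its trace-free part.
What remains is `inheritsRegularity_diagonal`, a statement about invariant maps `F` into an
arbitrary normed space, proved by induction on the size of the matrices.

Near a non-scalar matrix the eigenvalues split into two groups. A chart of the form `exp(S) y
exp(-S)`, with `S` skew and `y` block diagonal, turns `F` locally into a function of two smaller
blocks. The induction hypothesis applies to each block with the other as a parameter
(`InheritsRegularity.prod`, `contDiffAt_of_nonscalar`).

Treating the trace as a parameter leaves a single scalar matrix, the origin of the trace-free space.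
The order `n` Taylor polynomial at 0 of the restriction of `F` to the diagonal is symmetric, hence a
polynomial in power sums, and the power sums extend to the smooth invariants `tr(x^k)`. After
subtraction of this smooth invariant extension the remainder `G` vanishes to order `n` at 0 along
the diagonal. So `x ↦ (t ↦ t⁻ⁿ G(t x))` is an invariant map into `C([0,1], Y)` that is `C^n` on the
diagonal. The non-scalar case applies to this map as well, and its uniformity in `t` forces `G` to
be `C^n` at the origin (`contDiff_of_rescale`). This is why arbitrary normed targets are carried
through the induction. -/

theorem norm_sub_sub_smul_le {φ φ' : ℝ → Y} {c : Y} {ε t : ℝ}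
    (hφ : ∀ s, HasDerivAt φ (φ' s) s) (hε : ∀ s, |s| ≤ |t| → ‖φ' s - c‖ ≤ ε) :
    ‖φ t - φ 0 - t • c‖ ≤ ε * |t| := by
  have h := Convex.norm_image_sub_le_of_norm_hasDerivWithin_le (f := fun s => φ s - s • c)
    (f' := fun s => φ' s - c) (s := {s : ℝ | |s| ≤ |t|}) (x := 0) (y := t) (C := ε)
    (fun s _ => by
      have h := ((hφ s).sub ((hasDerivAt_id s).smul_const c)).hasDerivWithinAt
        (s := {s : ℝ | |s| ≤ |t|})
      rw [one_smul] at h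
      exact h)
    (fun s hs => hε s hs) ?_ (by simp) (by simp)
  · simpa [sub_right_comm] using h
  · have : {s : ℝ | |s| ≤ |t|} = Icc (-|t|) |t| := by ext; simp [abs_le]
    rw [this]; exact convex_Icc _ _

theorem hasDerivAt_comp_line {f : V → Y} {g : V → Y} {h : V}
    (hf : ∀ x, HasLineDerivAt ℝ f (g x) x h) (x : V) (s : ℝ) :
    HasDerivAt (fun s : ℝ => f (x + s • h)) (g (x + s • h)) s := by
  have h1 := (hf (x + s • h))
  unfold HasLineDerivAt at h1
  have h2 : HasDerivAt (fun r : ℝ => r - s) 1 s := by simpa using (hasDerivAt_id s).sub_const s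
  have h3 := HasDerivAt.scomp_of_eq s h1 h2 (sub_self s).symm
  simp only [one_smul] at h3
  refine h3.congr_of_eventuallyEq (Eventually.of_forall fun r => ?_)
  simp only [Function.comp_apply]
  congr 1
  module

/-- The coordinates are changed one at a time. In the sup norm every intermediate point stays within
`‖h‖` of `x`, so the mean value inequality controls each increment. -/
theorem hasFDerivAt_of_continuous_partial {ι : Type*} [Fintype ι] [DecidableEq ι]
    {f : (ι → ℝ) → Y} {g : ι → (ι → ℝ) → Y} (hg : ∀ i, Continuous (g i))
    (hf : ∀ i x, HasLineDerivAt ℝ f (g i x) x (Pi.single i 1)) (x : ι → ℝ) :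
    HasFDerivAt f (∑ i, (ContinuousLinearMap.proj (R := ℝ) (φ := fun _ : ι => ℝ) i).smulRight
      (g i x)) x := by
  rw [hasFDerivAt_iff_isLittleO_nhds_zero, Asymptotics.isLittleO_iff]
  intro c hc
  set ε : ℝ := c / (Fintype.card ι + 1)
  -- There are `card ι` increments, each with error at most `ε * ‖h‖`; the `+ 1` in the denominator
  -- covers empty `ι`.
  have hε : 0 < ε := by positivity
  obtain ⟨δ, hδ, hδ'⟩ : ∃ δ > 0, ∀ y, ‖y‖ < δ → ∀ i, ‖g i (x + y) - g i x‖ ≤ ε := by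
    have : ∀ᶠ y in 𝓝 (0 : ι → ℝ), ∀ i, ‖g i (x + y) - g i x‖ < ε := by
      rw [eventually_all]
      intro i
      have h1 : Continuous fun y => ‖g i (x + y) - g i x‖ :=
        (((hg i).comp (by fun_prop)).sub continuous_const).norm
      exact (h1.tendsto 0).eventually (gt_mem_nhds (by simpa using hε))
    obtain ⟨δ, hδ, h⟩ := Metric.eventually_nhds_iff.1 this
    exact ⟨δ, hδ, fun y hy i => (h (by simpa using hy) i).le⟩
  filter_upwards [Metric.ball_mem_nhds (0 : ι → ℝ) hδ] with h hh
  have hh' : ‖h‖ < δ := by simpa using hh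
  have key : ∀ s : Finset ι, ‖f (x + ∑ i ∈ s, h i • Pi.single i 1) - f x - ∑ i ∈ s, h i • g i x‖
      ≤ s.card * (ε * ‖h‖) := by
    intro s
    induction s using Finset.induction_on with
    | empty => simp
    | insert j s hj ih =>
      set p := ∑ i ∈ s, h i • (Pi.single i 1 : ι → ℝ) with hp
      have h1 := norm_sub_sub_smul_le (φ := fun t => f (x + p + t • Pi.single j 1))
        (c := g j x) (ε := ε) (t := h j) (fun s => hasDerivAt_comp_line (hf j) (x + p) s) ?_
      · rw [Finset.sum_insert hj, Finset.sum_insert hj, ← hp, Finset.card_insert_of_notMem hj]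
        have h2 : f (x + (h j • Pi.single j 1 + p)) - f x - (h j • g j x + ∑ i ∈ s, h i • g i x)
          = (f (x + p + h j • Pi.single j 1) - f (x + p + (0 : ℝ) • Pi.single j 1)
              - h j • g j x) + (f (x + p) - f x - ∑ i ∈ s, h i • g i x) := by
          rw [zero_smul, add_zero, add_assoc x p, add_comm p]; abel
        rw [h2]
        refine (norm_add_le _ _).trans ?_
        have h3 : ε * |h j| ≤ ε * ‖h‖ :=
          mul_le_mul_of_nonneg_left (norm_le_pi_norm h j) hε.le
        push_cast
        linarith
      · intro r hr
        rw [add_assoc]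
        apply hδ'
        refine lt_of_le_of_lt ?_ hh'
        rw [pi_norm_le_iff_of_nonneg (norm_nonneg _)]
        intro k
        have hpk : p k = if k ∈ s then h k else 0 := by
          simp [hp, Finset.sum_apply, Pi.single_apply]
        rw [Pi.add_apply, hpk]
        by_cases hk : k = j
        · subst hk
          simpa [hj] using hr.trans (norm_le_pi_norm h k)
        · by_cases hks : k ∈ s
          · simpa [hks, hk] using norm_le_pi_norm h k
          · simp [hks, hk]
  have h1 := key Finset.univ
  have h2 : ∑ i, h i • (Pi.single i 1 : ι → ℝ) = h := by
    ext k; simp [Finset.sum_apply, Pi.single_apply]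
  rw [h2] at h1
  simp only [sum_apply, ContinuousLinearMap.smulRight_apply,
    ContinuousLinearMap.proj_apply]
  refine h1.trans ?_
  rw [← mul_assoc]
  refine mul_le_mul_of_nonneg_right ?_ (norm_nonneg _)
  rw [Finset.card_univ, mul_div_assoc', div_le_iff₀ (by positivity)]
  nlinarith

theorem hasFDerivAt_of_continuous_lineDeriv [FiniteDimensional ℝ V] {f : V → Y} {g : V → V → Y}
    (hg : ∀ h, Continuous (g h)) (hf : ∀ h x, HasLineDerivAt ℝ f (g h x) x h) (x : V) :
    ∃ L : V →L[ℝ] Y, HasFDerivAt f L x ∧ ∀ h, L h = g h x := by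
  obtain ⟨L, hL⟩ : ∃ L : V →L[ℝ] Y, HasFDerivAt f L x := by
    let e := (Module.finBasis ℝ V).equivFunL
    have h1 := hasFDerivAt_of_continuous_partial (f := f ∘ e.symm)
      (g := fun i y => g (e.symm (Pi.single i 1)) (e.symm y))
      (fun i => (hg _).comp e.symm.continuous) (fun i y => by
        have := hf (e.symm (Pi.single i 1)) (e.symm y)
        unfold HasLineDerivAt at this ⊢
        simpa using this) (e x)
    have h2 := h1.comp x e.hasFDerivAt
    refine ⟨_, h2.congr_of_eventuallyEq (Eventually.of_forall fun y => ?_)⟩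
    simp
  exact ⟨L, hL, fun h => (hL.hasLineDerivAt h).unique (hf h x)⟩

theorem contDiff_succ_of_lineDeriv [FiniteDimensional ℝ V] {f : V → Y} {g : V → V → Y} {n : ℕ}
    (hg : ∀ h, ContDiff ℝ n (g h)) (hf : ∀ h x, HasLineDerivAt ℝ f (g h x) x h) :
    ContDiff ℝ (n + 1) f := by
  choose L hL hL' using hasFDerivAt_of_continuous_lineDeriv (fun h => (hg h).continuous) hf
  rw [contDiff_succ_iff_fderiv_apply]
  refine ⟨fun x => (hL x).differentiableAt, by simp, fun h => ?_⟩
  have : (fun x => fderiv ℝ f x h) = g h := by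
    funext x; rw [(hL x).fderiv, hL']
  rw [this]; exact hg h

/-- A function with values in a space of continuous functions on a compact space is `C^{n+1}` as
soon as it has pointwise directional derivatives that are `C^n`. -/
theorem contDiff_succ_of_pointwise_lineDeriv [FiniteDimensional ℝ V] {K : Type*}
    [TopologicalSpace K] [CompactSpace K] {f : V → C(K, Y)} {g : V → V → C(K, Y)} {n : ℕ}
    (hg : ∀ h, ContDiff ℝ n (g h))
    (hf : ∀ h x k, HasLineDerivAt ℝ (fun y => f y k) (g h x k) x h) :
    ContDiff ℝ (n + 1) f := by
  refine contDiff_succ_of_lineDeriv hg fun h x => ?_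
  rw [hasLineDerivAt_iff_isLittleO_nhds_zero, Asymptotics.isLittleO_iff]
  intro c hc
  -- Continuity of `g h` in the sup norm gives one `δ` for all `k`, so the pointwise mean value
  -- estimates become uniform.
  have h1 : ∀ᶠ s : ℝ in 𝓝 0, ‖g h (x + s • h) - g h x‖ < c := by
    have h1 : Continuous fun s : ℝ => ‖g h (x + s • h) - g h x‖ :=
      (((hg h).continuous.comp (by fun_prop)).sub continuous_const).norm
    exact (h1.tendsto 0).eventually (gt_mem_nhds (by simpa using hc))
  obtain ⟨δ, hδ, h2⟩ := Metric.eventually_nhds_iff.1 h1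
  filter_upwards [Metric.ball_mem_nhds (0 : ℝ) hδ] with t ht
  rw [ContinuousMap.norm_le _ (by positivity)]
  intro k
  have h3 := norm_sub_sub_smul_le (φ := fun s => f (x + s • h) k) (c := g h x k) (ε := c) (t := t)
    (hasDerivAt_comp_line (fun y => hf h y k) x) ?_
  · simpa using h3
  · intro s hs
    have h4 : dist s 0 < δ := by
      have := mem_ball_zero_iff.1 ht
      simp only [Real.norm_eq_abs] at this
      simpa using hs.trans_lt this
    exact ((g h (x + s • h) - g h x).norm_coe_le_norm k).trans (h2 h4).le

end Calculus

end MatrixFunctions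

namespace MatrixFunctions

open Filter Topology Set

/-! ### Maps into function spaces and joint regularity in two variables -/

section Currying

variable {V W Y : Type*} [NormedAddCommGroup V] [NormedSpace ℝ V]
  [NormedAddCommGroup W] [NormedSpace ℝ W] [NormedAddCommGroup Y] [NormedSpace ℝ Y]

/-- The directional derivatives of `u` are curried partial derivatives of `G`, so they have the same
form with one order less, and induction applies. -/
theorem contDiff_curry [FiniteDimensional ℝ V] {K : Type*} [TopologicalSpace K] [CompactSpace K]
    {κ : K → W}
    (hκ : Continuous κ) {n : ℕ} {G : V × W → Y} (hG : ContDiff ℝ n G) {u : V → C(K, Y)}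
    (hu : ∀ x k, u x k = G (x, κ k)) : ContDiff ℝ n u := by
  induction n generalizing G u with
  | zero =>
    rw [Nat.cast_zero, contDiff_zero] at hG ⊢
    have : u = ContinuousMap.curry ⟨fun p : V × K => G (p.1, κ p.2), by fun_prop⟩ := by
      funext x; ext k; simp [hu]
    rw [this]; exact ContinuousMap.continuous _
  | succ n ih =>
    push_cast at hG ⊢
    have hd : ∀ h : V, ContDiff ℝ n fun p => fderiv ℝ G p (h, 0) :=
      fun h => (contDiff_succ_iff_fderiv.1 hG).2.2.clm_apply contDiff_const
    refine contDiff_succ_of_pointwise_lineDeriv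
      (g := fun h x => ⟨fun k => fderiv ℝ G (x, κ k) (h, 0), ?_⟩) (fun h => ?_) fun h x k => ?_
    · exact (hd h).continuous.comp (by fun_prop)
    · exact ih (hd h) fun x k => rfl
    · have h1 : HasFDerivAt G (fderiv ℝ G (x, κ k)) (x, κ k) :=
        (hG.differentiable (by simp) _).hasFDerivAt
      have h2 := h1.hasLineDerivAt (h, 0)
      unfold HasLineDerivAt at h2 ⊢
      simpa [hu] using h2

/-- `G` is of class `C^n` in the first variable, locally uniformly in the second one. -/
def ContDiffFst [ProperSpace W] (n : ℕ) (G : V × W → Y) : Prop :=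
  ∀ R : ℝ, ∃ u : V → C(Metric.closedBall (0 : W) R, Y),
    ContDiff ℝ n u ∧ ∀ x k, u x k = G (x, k)

section

variable [ProperSpace W]

theorem ContDiffFst.continuous {W : Type*} [NormedAddCommGroup W] [ProperSpace W] {n : ℕ}
    {G : V × W → Y} (hG : ContDiffFst n G) :
    Continuous G := by
  rw [continuous_iff_continuousAt]
  rintro ⟨x, w⟩
  obtain ⟨u, hu, hu'⟩ := hG (‖w‖ + 1)
  have ho : IsOpen {p : V × W | ‖p.2‖ < ‖w‖ + 1} :=
    isOpen_lt (by fun_prop) continuous_const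
  have hc : ContinuousOn G {p : V × W | ‖p.2‖ < ‖w‖ + 1} := by
    rw [continuousOn_iff_continuous_domRestrict]
    have h1 : Continuous fun p : {p : V × W | ‖p.2‖ < ‖w‖ + 1} =>
        u p.1.1 ⟨p.1.2, by simpa using le_of_lt p.2⟩ := by
      have := hu.continuous
      fun_prop
    refine h1.congr fun p => ?_
    rw [hu']; rfl
  exact hc.continuousAt (ho.mem_nhds (by simp))

theorem ContDiffFst.exists_lineDeriv {n : ℕ} {G : V × W → Y} (hG : ContDiffFst (n + 1) G)
    (h : V) : ∃ D : V × W → Y, ContDiffFst n D ∧ ∀ p, HasLineDerivAt ℝ G (D p) p (h, 0) := by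
  have key : ∀ R : ℝ, ∃ v : V → C(Metric.closedBall (0 : W) R, Y), ContDiff ℝ n v ∧
      ∀ x k, HasLineDerivAt ℝ G (v x k) (x, (k : W)) (h, 0) := by
    intro R
    obtain ⟨u, hu, hu'⟩ := hG R
    push_cast at hu
    refine ⟨fun x => fderiv ℝ u x h, (contDiff_succ_iff_fderiv.1 hu).2.2.clm_apply contDiff_const,
      fun x k => ?_⟩
    have h1 := ((ContinuousMap.evalCLM ℝ k).hasFDerivAt.comp x
      (hu.differentiable (by simp) x).hasFDerivAt).hasLineDerivAt h
    unfold HasLineDerivAt at h1 ⊢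
    simpa [hu', Function.comp_def] using h1
  refine ⟨fun p => lineDeriv ℝ G p (h, 0), fun R => ?_, fun p => ?_⟩
  · obtain ⟨v, hv, hv'⟩ := key R
    exact ⟨v, hv, fun x k => (hv' x k).lineDeriv.symm⟩
  · obtain ⟨v, hv, hv'⟩ := key ‖p.2‖
    exact (hv' p.1 ⟨p.2, by simp⟩).lineDifferentiableAt.hasLineDerivAt

end

theorem contDiff_succ_of_partial_lineDeriv [FiniteDimensional ℝ V] [FiniteDimensional ℝ W] {n : ℕ}
    {G : V × W → Y}
    {D₁ : V → V × W → Y} {D₂ : W → V × W → Y} (h₁ : ∀ h, ContDiff ℝ n (D₁ h))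
    (h₂ : ∀ w, ContDiff ℝ n (D₂ w)) (h₁' : ∀ h p, HasLineDerivAt ℝ G (D₁ h p) p (h, 0))
    (h₂' : ∀ w p, HasLineDerivAt ℝ G (D₂ w p) p (0, w)) : ContDiff ℝ (n + 1) G := by
  have e₁ : ∀ p : V × W, ∃ L : V →L[ℝ] Y, HasFDerivAt (fun x => G (x, p.2)) L p.1 ∧
      ∀ h, L h = D₁ h p := fun p =>
    hasFDerivAt_of_continuous_lineDeriv (g := fun h x => D₁ h (x, p.2))
      (fun h => (h₁ h).continuous.comp (by fun_prop)) (fun h x => by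
        have := h₁' h (x, p.2)
        unfold HasLineDerivAt at this ⊢
        simpa using this) p.1
  have e₂ : ∀ p : V × W, ∃ L : W →L[ℝ] Y, HasFDerivAt (fun w => G (p.1, w)) L p.2 ∧
      ∀ h, L h = D₂ h p := fun p =>
    hasFDerivAt_of_continuous_lineDeriv (g := fun h w => D₂ h (p.1, w))
      (fun h => (h₂ h).continuous.comp (by fun_prop)) (fun h w => by
        have := h₂' h (p.1, w)
        unfold HasLineDerivAt at this ⊢
        simpa using this) p.2
  choose L₁ hL₁ hL₁' using e₁
  choose L₂ hL₂ hL₂' using e₂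
  have c₁ : Continuous L₁ := continuous_clm_apply.2 fun h => by
    simpa only [hL₁'] using (h₁ h).continuous
  have c₂ : Continuous L₂ := continuous_clm_apply.2 fun h => by
    simpa only [hL₂'] using (h₂ h).continuous
  have key : ∀ p, HasFDerivAt G ((L₁ p).coprod (L₂ p)) p := fun p =>
    (hasStrictFDerivAt_uncurry_coprod (f := fun x w => G (x, w)) (f₁ := fun x w => L₁ (x, w))
      (f₂ := fun x w => L₂ (x, w)) (u := p) (Eventually.of_forall hL₁) (Eventually.of_forall hL₂)
      c₁.continuousAt c₂.continuousAt).hasFDerivAt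
  rw [contDiff_succ_iff_fderiv_apply]
  refine ⟨fun p => (key p).differentiableAt, by simp, fun y => ?_⟩
  have : (fun p => fderiv ℝ G p y) = fun p => D₁ y.1 p + D₂ y.2 p := by
    funext p
    rw [(key p).fderiv, ContinuousLinearMap.coprod_apply, hL₁', hL₂']
  rw [this]
  exact (h₁ _).add (h₂ _)

/-- Interchange of directional derivatives. -/
theorem hasLineDerivAt_swap [FiniteDimensional ℝ V] {G D₁ D₂ : V × W → Y} {h : V} {w : W}
    (h₁ : ∀ p, HasLineDerivAt ℝ G (D₁ p) p (h, 0)) (h₂ : ∀ p, HasLineDerivAt ℝ G (D₂ p) p (0, w))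
    (hD₂ : ContDiff ℝ 1 D₂) (p : V × W) :
    HasLineDerivAt ℝ D₁ (fderiv ℝ D₂ p (h, 0)) p (0, w) := by
  obtain ⟨x, w₀⟩ := p
  let κ : Icc (-1 : ℝ) 1 → W := fun t => w₀ + (t : ℝ) • w
  have hκ : Continuous κ := by fun_prop
  let U : V → C(Icc (-1 : ℝ) 1, Y) := fun y => ⟨fun t => D₂ (y, κ t), by
    have := hD₂.continuous
    fun_prop⟩
  have hU : ContDiff ℝ (1 : ℕ) U :=
    contDiff_curry hκ (G := D₂) (by simpa using hD₂) fun x k => rfl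
  have hU' : HasFDerivAt U (fderiv ℝ U x) x :=
    (hU.differentiable (by simp) x).hasFDerivAt
  have hUh : ∀ t : Icc (-1 : ℝ) 1, fderiv ℝ U x h t = fderiv ℝ D₂ (x, κ t) (h, 0) := by
    intro t
    have e1 := ((ContinuousMap.evalCLM ℝ t).hasFDerivAt.comp x hU').hasLineDerivAt h
    have e2 := (hD₂.differentiable (by simp) (x, κ t)).hasFDerivAt.hasLineDerivAt (h, 0)
    unfold HasLineDerivAt at e1 e2
    have e3 : (fun s : ℝ => (⇑(ContinuousMap.evalCLM ℝ t) ∘ U) (x + s • h)) =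
      fun s : ℝ => D₂ ((x, κ t) + s • (h, 0)) := by funext s; simp [U]
    rw [e3] at e1
    simpa using e1.unique e2
  have hslope := (hasLineDerivAt_iff_tendsto_slope_zero.1 (hU'.hasLineDerivAt h))
  have key : HasDerivAt (fun t : ℝ => D₁ (x, w₀ + t • w))
      (fderiv ℝ D₂ (x, w₀ + (0 : ℝ) • w) (h, 0)) 0 := by
    -- `D₁` is the limit of difference quotients of `G` in direction `h`. Their derivatives along
    -- `w` are difference quotients of `D₂`, which converge uniformly in `t` because `U` is
    -- differentiable in the sup norm.
    refine hasDerivAt_of_tendstoUniformlyOn (l := 𝓝[≠] (0 : ℝ)) (s := Ioo (-1 : ℝ) 1) isOpen_Ioo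
      (f := fun s t => s⁻¹ • (G (x + s • h, w₀ + t • w) - G (x, w₀ + t • w)))
      (f' := fun s t => s⁻¹ • (D₂ (x + s • h, w₀ + t • w) - D₂ (x, w₀ + t • w)))
      (g' := fun t => fderiv ℝ D₂ (x, w₀ + t • w) (h, 0)) ?_ ?_ ?_ (by simp)
    · rw [Metric.tendstoUniformlyOn_iff]
      intro ε hε
      filter_upwards [Metric.tendsto_nhds.1 hslope ε hε] with s hs t ht
      have e1 := (ContinuousMap.dist_apply_le_dist
        (⟨t, ht.1.le, ht.2.le⟩ : Icc (-1 : ℝ) 1)).trans_lt hs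
      rw [dist_comm, hUh] at e1
      simpa [U, κ] using e1
    · refine Eventually.of_forall fun s t _ => ?_
      have e : ∀ y : V, HasDerivAt (fun t : ℝ => G (y, w₀ + t • w)) (D₂ (y, w₀ + t • w)) t := by
        intro y
        simpa using hasDerivAt_comp_line h₂ (y, w₀) t
      exact ((e _).sub (e _)).const_smul _
    · intro t _
      have e1 := hasLineDerivAt_iff_tendsto_slope_zero.1 (h₁ (x, w₀ + t • w))
      simpa using e1
  unfold HasLineDerivAt
  simpa using key

/-- It suffices that the partial derivatives `D₁ h` are jointly `C^n`. They satisfy the same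
hypotheses one order lower, since their derivatives along `W` are derivatives of `D w` by
interchange. -/
theorem contDiff_succ_of_contDiffFst [FiniteDimensional ℝ V] [FiniteDimensional ℝ W] {n : ℕ}
    {G : V × W → Y}
    (hG : ContDiffFst (n + 1) G) {D : W → V × W → Y} (hD : ∀ w, ContDiff ℝ n (D w))
    (hD' : ∀ w p, HasLineDerivAt ℝ G (D w p) p (0, w)) : ContDiff ℝ (n + 1) G := by
  induction n generalizing G D with
  | zero =>
    choose D₁ h₁ h₁' using hG.exists_lineDeriv
    refine contDiff_succ_of_partial_lineDeriv (n := 0) (D₁ := D₁) (fun h => ?_) hD h₁' hD'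
    simpa using (h₁ h).continuous
  | succ n ih =>
    choose D₁ h₁ h₁' using hG.exists_lineDeriv
    refine contDiff_succ_of_partial_lineDeriv (D₁ := D₁) (fun h => ?_) hD h₁' hD'
    push_cast
    refine ih (h₁ h) (D := fun w p => fderiv ℝ (D w) p (h, 0)) (fun w => ?_) fun w p => ?_
    · have := hD w
      push_cast at this
      exact (contDiff_succ_iff_fderiv.1 this).2.2.clm_apply contDiff_const
    · exact hasLineDerivAt_swap (h₁' h) (hD' w) ((hD w).of_le (by push_cast; simp)) p

end Currying

/-! ### Inheritance of regularity, with parameters -/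

section Invariance

universe u

variable {V D W : Type} [NormedAddCommGroup V] [NormedSpace ℝ V]
  [NormedAddCommGroup D] [NormedSpace ℝ D] [FiniteDimensional ℝ D]
  [NormedAddCommGroup W] [NormedSpace ℝ W] [FiniteDimensional ℝ W]

/-- Functions on `V` that are constant on `r`-related points inherit their regularity from their
restriction along `i : D → V`. -/
def InheritsRegularity (i : D → V) (r : V → V → Prop) : Prop :=
  ∀ (Y : Type u) [NormedAddCommGroup Y] [NormedSpace ℝ Y] (n : ℕ) (F : V → Y),
    (∀ x y, r x y → F x = F y) → ContDiff ℝ n (F ∘ i) → ContDiff ℝ n F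

/-- The parameter is absorbed into the target: the hypothesis is applied to `x ↦ G(x, ·)` with
values in continuous functions on a ball. -/
theorem InheritsRegularity.contDiffFst {i : D → V} {r : V → V → Prop}
    (H : InheritsRegularity.{u} i r) (hr : ∀ x, ∃ δ, r x (i δ)) {Y : Type u}
    [NormedAddCommGroup Y] [NormedSpace ℝ Y] {n : ℕ} {G : V × W → Y}
    (hG : ∀ x y w, r x y → G (x, w) = G (y, w))
    (hGi : ContDiff ℝ n fun p : D × W => G (i p.1, p.2)) : ContDiffFst n G := by
  choose ρ hρ using hr
  intro R
  have hc : ∀ x, Continuous fun k : Metric.closedBall (0 : W) R => G (x, k) := fun x => by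
    simp only [fun k => hG x _ k (hρ x)]
    exact hGi.continuous.comp (f := fun k : Metric.closedBall (0 : W) R => (ρ x, (k : W)))
      (by fun_prop)
  refine ⟨fun x => ⟨fun k => G (x, k), hc x⟩, H _ n _ (fun x y hxy => ?_) ?_, fun x k => rfl⟩
  · ext k; exact hG x y k hxy
  · exact contDiff_curry (κ := fun k : Metric.closedBall (0 : W) R => (k : W))
      continuous_subtype_val hGi fun x k => rfl

/-- Regularity is still inherited in the presence of parameters in which the function is jointly
regular. -/
theorem InheritsRegularity.prod [FiniteDimensional ℝ V] {i : D → V} {r : V → V → Prop}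
    (H : InheritsRegularity.{u} i r) (hr : ∀ x, ∃ δ, r x (i δ)) {Y : Type u}
    [NormedAddCommGroup Y] [NormedSpace ℝ Y] {n : ℕ} {G : V × W → Y}
    (hG : ∀ x y w, r x y → G (x, w) = G (y, w))
    (hGi : ContDiff ℝ n fun p : D × W => G (i p.1, p.2)) : ContDiff ℝ n G := by
  choose ρ hρ using id hr
  induction n generalizing G with
  | zero => simpa using (H.contDiffFst hr hG hGi).continuous
  | succ n ih =>
    push_cast at hGi ⊢
    have hd : ∀ w : W, ∀ p : V × W, HasLineDerivAt ℝ G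
        (fderiv ℝ (fun p : D × W => G (i p.1, p.2)) (ρ p.1, p.2) (0, w)) p (0, w) := by
      intro w p
      have h1 := (hGi.differentiable (by simp) (ρ p.1, p.2)).hasFDerivAt.hasLineDerivAt (0, w)
      unfold HasLineDerivAt at h1 ⊢
      refine h1.congr_of_eventuallyEq (Eventually.of_forall fun t => ?_)
      have h2 := hG _ _ (p.2 + t • w) (hρ p.1)
      obtain ⟨x, w'⟩ := p
      simpa using h2
    -- The relation does not involve the parameter, so parameter derivatives are again invariant and
    -- the induction on `n` applies to them.
    have hinv : ∀ w x y w', r x y →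
        lineDeriv ℝ G (x, w') (0, w) = lineDeriv ℝ G (y, w') (0, w) := by
      intro w x y w' hxy
      unfold lineDeriv
      simp [hG x y _ hxy]
    have hreg : ∀ w, ContDiff ℝ n fun p : D × W => lineDeriv ℝ G (i p.1, p.2) (0, w) := by
      intro w
      have h1 : (fun p : D × W => lineDeriv ℝ G (i p.1, p.2) (0, w)) =
          fun p => fderiv ℝ (fun p : D × W => G (i p.1, p.2)) p (0, w) := by
        funext p
        refine HasLineDerivAt.lineDeriv ?_
        have h1 := (hGi.differentiable (by simp) p).hasFDerivAt.hasLineDerivAt (0, w)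
        unfold HasLineDerivAt at h1 ⊢
        simpa using h1
      rw [h1]
      exact (contDiff_succ_iff_fderiv.1 hGi).2.2.clm_apply contDiff_const
    refine contDiff_succ_of_contDiffFst (H.contDiffFst hr hG (by exact_mod_cast hGi))
      (D := fun w p => lineDeriv ℝ G p (0, w)) (fun w => ?_)
      fun w p => (hd w p).lineDifferentiableAt.hasLineDerivAt
    exact ih (hinv w) (hreg w)

end Invariance

end MatrixFunctions

namespace MatrixFunctions

open Filter Topology Set

/-! ### Functions vanishing to order `n` and their rescalings -/

section Rescaling

variable {V Y : Type*} [NormedAddCommGroup V] [NormedSpace ℝ V]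
  [NormedAddCommGroup Y] [NormedSpace ℝ Y]

/-- At `t = 0` both sides vanish by `0⁻¹ = 0`, except the right side when `n = 0`; that case needs
`y = 0`. -/
theorem inv_pow_succ_mul_self_smul {t : ℝ} {n : ℕ} {y : Y} (h : t = 0 → y = 0) :
    ((t ^ (n + 1))⁻¹ * t) • y = (t ^ n)⁻¹ • y := by
  rcases eq_or_ne t 0 with ht | ht
  · simp [h ht]
  · congr 1; field_simp; ring

/-- If `f` vanishes to order `n` at the origin, then the rescaled functions `t⁻ⁿ f(t x)` depend on
`x` in a `C^n` way uniformly in `t ∈ [0, 1]`. -/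
theorem exists_contDiff_rescale [FiniteDimensional ℝ V] {f : V → Y} {n : ℕ}
    (hf : ContDiff ℝ n f) (h0 : ∀ k ≤ n, iteratedFDeriv ℝ k f 0 = 0) :
    ∃ u : V → C(Icc (0 : ℝ) 1, Y), ContDiff ℝ n u ∧
      ∀ x t, u x t = ((t : ℝ) ^ n)⁻¹ • f ((t : ℝ) • x) := by
  induction n generalizing f with
  | zero =>
    have hc : Continuous f := hf.continuous
    let c : C(V × Icc (0 : ℝ) 1, Y) := ⟨fun p => f ((p.2 : ℝ) • p.1), by fun_prop⟩
    exact ⟨c.curry, by simpa using c.curry.continuous, fun x t => by simp [c]⟩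
  | succ n ih =>
    have hdf : ContDiff ℝ n (fderiv ℝ f) := by
      push_cast at hf; exact (contDiff_succ_iff_fderiv.1 hf).2.2
    have hdiff : Differentiable ℝ f := hf.differentiable (by simp)
    have hv : ∀ h : V, ∃ u : V → C(Icc (0 : ℝ) 1, Y), ContDiff ℝ n u ∧
        ∀ x t, u x t = ((t : ℝ) ^ n)⁻¹ • fderiv ℝ f ((t : ℝ) • x) h := fun h => by
      refine ih (f := fun x => fderiv ℝ f x h) (hdf.clm_apply contDiff_const) fun k hk => ?_
      have h1 := (ContinuousLinearMap.apply ℝ Y h).iteratedFDeriv_comp_left (i := k)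
        (x := (0 : V)) hdf.contDiffAt (by exact_mod_cast hk)
      have h2 : iteratedFDeriv ℝ k (fderiv ℝ f) 0 = 0 := by
        rw [← norm_eq_zero, norm_iteratedFDeriv_fderiv, h0 (k + 1) (by omega), norm_zero]
      have h3 : (ContinuousLinearMap.apply ℝ Y h) ∘ fderiv ℝ f = fun x => fderiv ℝ f x h := by
        funext x; simp
      rw [h3, h2] at h1
      rw [h1]; ext; simp
    choose v hv hv' using hv
    have hf0 : f 0 = 0 := by
      have := h0 0 (by omega)
      rw [← norm_eq_zero, norm_iteratedFDeriv_zero, norm_eq_zero] at this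
      exact this
    have hdf0 : fderiv ℝ f 0 = 0 := by
      rw [← norm_eq_zero, ← norm_iteratedFDeriv_one, h0 1 (by omega), norm_zero]
    -- The mean value inequality on `[0, t]` bounds the rescaled function by the rescaled
    -- derivative, which yields continuity at `t = 0`.
    have hbound : ∀ x (t : Icc (0 : ℝ) 1) (ε : ℝ), (∀ s ≤ t, ‖v x x s‖ ≤ ε) →
        ‖((t : ℝ) ^ (n + 1))⁻¹ • f ((t : ℝ) • x)‖ ≤ ε := by
      intro x t ε hε
      have hε0 : 0 ≤ ε := (norm_nonneg _).trans (hε t le_rfl)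
      rcases eq_or_lt_of_le t.2.1 with ht | ht
      · simpa [← ht] using hε0
      have h1 := Convex.norm_image_sub_le_of_norm_hasDerivWithin_le
        (f := fun s : ℝ => f (s • x)) (f' := fun s => fderiv ℝ f (s • x) x)
        (s := Icc (0 : ℝ) t) (x := 0) (y := t) (C := ε * (t : ℝ) ^ n)
        (fun s _ => by
          have := hasDerivAt_comp_line (f := f) (g := fun y => fderiv ℝ f y x) (h := x)
            (fun y => (hdiff y).hasFDerivAt.hasLineDerivAt x) 0 s
          simpa using this.hasDerivWithinAt)
        (fun s hs => by
          have hs1 : s ≤ 1 := hs.2.trans t.2.2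
          have h2 := hε ⟨s, hs.1, hs1⟩ hs.2
          rw [hv'] at h2
          rcases eq_or_lt_of_le hs.1 with hs0 | hs0
          · rw [← hs0]; simp only [zero_smul, hdf0]; simp; positivity
          · rw [norm_smul, norm_inv, norm_pow, Real.norm_of_nonneg hs.1,
              inv_mul_le_iff₀ (by positivity)] at h2
            refine h2.trans ?_
            rw [mul_comm]
            exact mul_le_mul_of_nonneg_left (pow_le_pow_left₀ hs.1 hs.2 n) hε0)
        (convex_Icc _ _) (by simp [ht.le]) (by simp [ht.le])
      simp only [zero_smul, hf0, sub_zero, Real.norm_of_nonneg ht.le] at h1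
      rw [norm_smul, norm_inv, norm_pow, Real.norm_of_nonneg ht.le,
        inv_mul_le_iff₀ (by positivity), pow_succ]
      linarith
    have hcont : ∀ x, Continuous fun t : Icc (0 : ℝ) 1 =>
        ((t : ℝ) ^ (n + 1))⁻¹ • f ((t : ℝ) • x) := by
      intro x
      rw [continuous_iff_continuousAt]
      intro t
      rcases eq_or_ne (t : ℝ) 0 with ht | ht
      · have ht' : t = ⟨0, by simp⟩ := Subtype.ext ht
        subst ht'
        rw [Metric.continuousAt_iff]
        intro ε hε
        have h1 : v x x ⟨0, by simp⟩ = 0 := by rw [hv']; simp [hdf0]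
        obtain ⟨δ, hδ, h2⟩ := Metric.continuousAt_iff.1
          (v x x).continuous.continuousAt (ε / 2) (half_pos hε)
        refine ⟨δ, hδ, fun {t} htd => ?_⟩
        have h3 := hbound x t (ε / 2) fun s hs => by
          have h4 : dist s ⟨0, by simp⟩ < δ := by
            refine lt_of_le_of_lt ?_ htd
            rw [Subtype.dist_eq, Subtype.dist_eq]
            simpa [abs_of_nonneg s.2.1, abs_of_nonneg t.2.1] using hs
          have := h2 h4
          rw [h1, dist_zero_right] at this
          exact this.le
        simp only [zero_smul, hf0, smul_zero, dist_zero_right]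
        linarith
      · refine ContinuousAt.smul (ContinuousAt.inv₀ (by fun_prop) (by positivity)) ?_
        exact (hdiff.continuous.comp (by fun_prop)).continuousAt
    refine ⟨fun x => ⟨_, hcont x⟩, ?_, fun x t => rfl⟩
    push_cast
    refine contDiff_succ_of_pointwise_lineDeriv hv fun h x t => ?_
    have h1 := (hdiff ((t : ℝ) • x)).hasFDerivAt.hasLineDerivAt ((t : ℝ) • h)
    unfold HasLineDerivAt at h1 ⊢
    have h2 := h1.const_smul (((t : ℝ) ^ (n + 1))⁻¹)
    have h3 : ((t : ℝ) ^ (n + 1))⁻¹ • fderiv ℝ f ((t : ℝ) • x) ((t : ℝ) • h) = v h x t := by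
      rw [map_smul, smul_smul, hv']
      exact inv_pow_succ_mul_self_smul fun ht => by simp [ht, hdf0]
    rw [h3] at h2
    refine h2.congr_of_eventuallyEq (Eventually.of_forall fun s => ?_)
    simp [smul_add, smul_comm s]

/-- In polar form `y = t x` with `t = ‖y‖`, one has `g y = tⁿ u x t`. Since `u x 0 = 0`, compactness
of the unit sphere makes `u x t` small for small `t`, uniformly in `x`. -/
theorem exists_norm_le_of_rescale [FiniteDimensional ℝ V] {g : V → Y} {n : ℕ} (h0 : g 0 = 0)
    {u : V → C(Icc (0 : ℝ) 1, Y)} (hu : ContinuousOn u {0}ᶜ)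
    (hug : ∀ x ≠ 0, ∀ t, u x t = ((t : ℝ) ^ n)⁻¹ • g ((t : ℝ) • x)) {ε : ℝ} (hε : 0 < ε) :
    ∀ᶠ y in 𝓝 (0 : V), ‖g y‖ ≤ ε * ‖y‖ ^ n := by
  have hS : IsCompact (Metric.sphere (0 : V) 1) := isCompact_sphere _ _
  have h1 := hS.eventually_forall_of_forall_eventually (x₀ := (⟨0, by simp⟩ : Icc (0 : ℝ) 1))
    (P := fun t x => ‖u x t‖ < ε) (fun x hx => by
      have hx0 : x ≠ 0 := by rintro rfl; simp at hx
      have hc : ContinuousAt (fun z : Icc (0 : ℝ) 1 × V => ‖u z.2 z.1‖) (⟨0, by simp⟩, x) := by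
        have h2 : ContinuousAt u x := hu.continuousAt (isOpen_compl_singleton.mem_nhds hx0)
        exact (ContinuousAt.eval (ContinuousAt.comp (f := Prod.snd) h2 continuousAt_snd)
          continuousAt_fst).norm
      refine hc.eventually (gt_mem_nhds ?_)
      simpa [hug x hx0, h0] using hε)
  obtain ⟨δ, hδ, h2⟩ := Metric.eventually_nhds_iff.1 h1
  filter_upwards [Metric.ball_mem_nhds (0 : V) (lt_min hδ one_pos)] with y hy
  rw [mem_ball_zero_iff, lt_min_iff] at hy
  rcases eq_or_ne y 0 with rfl | hy0
  · rw [h0, norm_zero]; positivity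
  have hn : 0 < ‖y‖ := norm_pos_iff.2 hy0
  have h3 := h2 (y := ⟨‖y‖, hn.le, hy.2.le⟩) (by simpa [Subtype.dist_eq] using hy.1)
    (‖y‖⁻¹ • y) (by simp [norm_smul, hn.ne'])
  rw [hug _ (by simp [hy0])] at h3
  simp only [smul_smul, mul_inv_cancel₀ hn.ne', one_smul] at h3
  rw [norm_smul, norm_inv, norm_pow, norm_norm, inv_mul_lt_iff₀ (by positivity)] at h3
  linarith

/-- If the rescaled functions `t⁻ⁿ g(t x)` depend on `x ≠ 0` in a `C^n` way uniformly in
`t ∈ [0, 1]`, then `g` is `C^n`, at the origin as well. -/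
theorem contDiff_of_rescale [FiniteDimensional ℝ V] {g : V → Y} {n : ℕ} (h0 : g 0 = 0)
    {u : V → C(Icc (0 : ℝ) 1, Y)} (hu : ContDiffOn ℝ n u {0}ᶜ)
    (hug : ∀ x ≠ 0, ∀ t, u x t = ((t : ℝ) ^ n)⁻¹ • g ((t : ℝ) • x)) : ContDiff ℝ n g := by
  have hg1 : ∀ x ≠ 0, g x = u x ⟨1, by simp⟩ := fun x hx => by simp [hug x hx]
  induction n generalizing g u with
  | zero =>
    rw [Nat.cast_zero, contDiff_zero, continuous_iff_continuousAt]
    intro x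
    rcases eq_or_ne x 0 with rfl | hx
    · rw [Metric.continuousAt_iff']
      intro ε hε
      filter_upwards [exists_norm_le_of_rescale h0 hu.continuousOn hug (half_pos hε)] with y hy
      rw [h0, dist_zero_right]
      simp only [pow_zero, mul_one] at hy
      linarith
    · have hn : ({0}ᶜ : Set V) ∈ 𝓝 x := isOpen_compl_singleton.mem_nhds hx
      refine ContinuousAt.congr ?_ (eventually_of_mem hn fun y hy => (hg1 y hy).symm)
      exact ContinuousAt.eval (hu.continuousOn.continuousAt hn) continuousAt_const
  | succ n ih =>
    push_cast at hu ⊢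
    have hu1 := (contDiffOn_succ_iff_fderiv_of_isOpen isOpen_compl_singleton).1 hu
    have hdu : ∀ x ≠ 0, HasFDerivAt u (fderiv ℝ u x) x := fun x hx =>
      ((hu1.1 x hx).differentiableAt (isOpen_compl_singleton.mem_nhds hx)).hasFDerivAt
    -- Near 0, `‖g y‖ ≤ c ‖y‖^(n+1) ≤ c ‖y‖` for every `c > 0`.
    have hd0 : HasFDerivAt g (0 : V →L[ℝ] Y) 0 := by
      rw [hasFDerivAt_iff_isLittleO_nhds_zero, Asymptotics.isLittleO_iff]
      intro c hc
      filter_upwards [exists_norm_le_of_rescale h0 hu.continuousOn hug hc,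
        Metric.ball_mem_nhds (0 : V) one_pos] with y hy hy1
      rw [mem_ball_zero_iff] at hy1
      simp only [zero_add, h0, sub_zero, zero_apply]
      refine hy.trans (mul_le_mul_of_nonneg_left ?_ hc.le)
      rw [pow_succ]
      exact mul_le_of_le_one_left (norm_nonneg _) (pow_le_one₀ (norm_nonneg _) hy1.le)
    have hd : Differentiable ℝ g := by
      intro x
      rcases eq_or_ne x 0 with rfl | hx
      · exact hd0.differentiableAt
      · exact (((ContinuousMap.evalCLM ℝ (⟨1, by simp⟩ : Icc (0 : ℝ) 1)).hasFDerivAt.comp x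
          (hdu x hx)).congr_of_eventuallyEq (eventually_of_mem
            (isOpen_compl_singleton.mem_nhds hx) fun y hy => hg1 y hy)).differentiableAt
    rw [contDiff_succ_iff_fderiv_apply]
    refine ⟨hd, by simp, fun h => ?_⟩
    -- The chain rule cancels one factor `t`, so the derivatives of `g` satisfy the hypotheses at
    -- order `n`.
    have hug' : ∀ x ≠ 0, ∀ t : Icc (0 : ℝ) 1,
        fderiv ℝ u x h t = ((t : ℝ) ^ n)⁻¹ • fderiv ℝ g ((t : ℝ) • x) h := by
      intro x hx t
      have e1 := (((ContinuousMap.evalCLM ℝ t).hasFDerivAt.comp x (hdu x hx)).congr_of_eventuallyEq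
        (eventually_of_mem (isOpen_compl_singleton.mem_nhds hx)
          fun y hy => (hug y hy t).symm)).hasLineDerivAt h
      have e2 := (hd ((t : ℝ) • x)).hasFDerivAt.hasLineDerivAt ((t : ℝ) • h)
      unfold HasLineDerivAt at e1 e2
      have e3 := e2.const_smul (((t : ℝ) ^ (n + 1))⁻¹)
      have e4 := e1.unique (e3.congr_of_eventuallyEq
        (Eventually.of_forall fun s => by simp [smul_add, smul_comm s]))
      rw [map_smul, smul_smul, inv_pow_succ_mul_self_smul fun ht => by simp [ht, hd0.fderiv]] at e4
      simpa using e4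
    refine ih (u := fun x => fderiv ℝ u x h) (by simp [hd0.fderiv])
      (hu1.2.2.clm_apply contDiffOn_const) hug' fun x hx => ?_
    simp [hug' x hx]

end Rescaling

end MatrixFunctions

namespace MatrixFunctions

open Filter Topology Set

/-! ### Symmetry of higher derivatives and the Taylor polynomial -/

section Taylor

variable {V Y : Type*} [NormedAddCommGroup V] [NormedSpace ℝ V]
  [NormedAddCommGroup Y] [NormedSpace ℝ Y]

theorem iteratedFDeriv_succ_apply_eq_fderiv {f : V → Y} {k : ℕ} (hf : ContDiff ℝ (k + 1) f)
    (x : V) (v : Fin (k + 1) → V) :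
    iteratedFDeriv ℝ (k + 1) f x v =
      fderiv ℝ (fun y => iteratedFDeriv ℝ k f y (Fin.tail v)) x (v 0) := by
  have h1 : DifferentiableAt ℝ (iteratedFDeriv ℝ k f) x :=
    (hf.differentiable_iteratedFDeriv (by exact_mod_cast Nat.lt_succ_self k)) x
  have h2 := (ContinuousMultilinearMap.apply ℝ (fun _ : Fin k => V) Y
    (Fin.tail v)).hasFDerivAt.comp x h1.hasFDerivAt
  rw [iteratedFDeriv_succ_apply_left]
  have h3 : (fun y => iteratedFDeriv ℝ k f y (Fin.tail v)) =
    (ContinuousMultilinearMap.apply ℝ (fun _ : Fin k => V) Y (Fin.tail v)) ∘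
      iteratedFDeriv ℝ k f := by funext y; simp
  rw [h3, h2.fderiv]
  simp

/-- The iterated derivatives of a `C^n` function are symmetric. -/
theorem iteratedFDeriv_comp_perm_of_contDiff {f : V → Y} {k : ℕ} (hf : ContDiff ℝ k f) (x : V)
    (v : Fin k → V) (σ : Equiv.Perm (Fin k)) :
    iteratedFDeriv ℝ k f x (v ∘ σ) = iteratedFDeriv ℝ k f x v := by
  induction k generalizing x with
  | zero => congr 1; exact Subsingleton.elim _ _
  | succ k ih =>
    have ih' := fun x v σ => ih (hf.of_le (by exact_mod_cast Nat.le_succ k)) x v σ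
    let S : Submonoid (Equiv.Perm (Fin (k + 1))) :=
      { carrier := {σ | ∀ v : Fin (k + 1) → V,
          iteratedFDeriv ℝ (k + 1) f x (v ∘ σ) = iteratedFDeriv ℝ (k + 1) f x v}
        one_mem' := fun v => rfl
        mul_mem' := fun {σ τ} hσ hτ v => by
          have : v ∘ ⇑(σ * τ) = (v ∘ σ) ∘ τ := rfl
          rw [this, hτ, hσ] }
    -- Adjacent transpositions generate. The first one is the symmetry of a second derivative; the
    -- others act on the tail and fall under the induction hypothesis.
    have key : Submonoid.closure (Set.range fun i : Fin k => Equiv.swap i.castSucc i.succ) ≤ S := by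
      rw [Submonoid.closure_le]
      rintro _ ⟨i, rfl⟩ v
      obtain _ | k := k
      · exact i.elim0
      refine Fin.cases ?_ (fun j => ?_) i
      · have hg : ∀ w : Fin k → V, ContDiff ℝ 2 fun y => iteratedFDeriv ℝ k f y w := fun w => by
          have h1 : ContDiff ℝ 2 (iteratedFDeriv ℝ k f) :=
            hf.iteratedFDeriv_right (by norm_cast; omega)
          exact (ContinuousMultilinearMap.apply ℝ (fun _ : Fin k => V) Y w).contDiff.comp h1
        have h2 : ∀ v : Fin (k + 2) → V, iteratedFDeriv ℝ (k + 2) f x v =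
            fderiv ℝ (fderiv ℝ fun y => iteratedFDeriv ℝ k f y (Fin.tail (Fin.tail v))) x
              (v 0) (v 1) := by
          intro v
          rw [iteratedFDeriv_succ_apply_eq_fderiv (by exact_mod_cast hf)]
          have h3 : (fun y => iteratedFDeriv ℝ (k + 1) f y (Fin.tail v)) = fun y =>
              fderiv ℝ (fun y => iteratedFDeriv ℝ k f y (Fin.tail (Fin.tail v))) y (v 1) := by
            funext y
            rw [iteratedFDeriv_succ_apply_eq_fderiv
              (hf.of_le (by exact_mod_cast Nat.le_succ (k + 1)))]
            rfl
          rw [h3]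
          have h4 : DifferentiableAt ℝ
              (fderiv ℝ fun y => iteratedFDeriv ℝ k f y (Fin.tail (Fin.tail v))) x :=
            ((hg _).fderiv_right (m := 1) (by norm_num)).differentiable (by simp) x
          rw [fderiv_clm_apply h4 (differentiableAt_const _)]
          simp
        rw [h2, h2]
        have h5 : Fin.tail (Fin.tail (v ∘ Equiv.swap (Fin.castSucc 0) (Fin.succ 0))) =
            Fin.tail (Fin.tail v) := by
          funext j
          simp only [Fin.tail, Function.comp_apply]
          rw [Equiv.swap_apply_of_ne_of_ne]
          · exact Fin.succ_ne_zero _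
          · exact fun h => Fin.succ_ne_zero _ (Fin.succ_injective _ h)
        rw [h5]
        have h6 := ((hg (Fin.tail (Fin.tail v))).contDiffAt (x := x)).isSymmSndFDerivAt
          (by simp) (v 1) (v 0)
        simpa using h6
      · rw [iteratedFDeriv_succ_apply_eq_fderiv (by exact_mod_cast hf),
          iteratedFDeriv_succ_apply_eq_fderiv (by exact_mod_cast hf)]
        have h1 : Fin.tail (v ∘ Equiv.swap j.succ.castSucc j.succ.succ) =
            Fin.tail v ∘ Equiv.swap j.castSucc j.succ := by
          funext a
          simp only [Fin.tail, Function.comp_apply]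
          rw [← Fin.succ_castSucc, (Fin.succ_injective _).swap_apply]
        have h2 : (v ∘ Equiv.swap j.succ.castSucc j.succ.succ) 0 = v 0 := by
          simp only [Function.comp_apply]
          rw [Equiv.swap_apply_of_ne_of_ne]
          · rw [← Fin.succ_castSucc]; exact (Fin.succ_ne_zero _).symm
          · exact (Fin.succ_ne_zero _).symm
        rw [h1, h2]
        simp only [ih']
    rw [Equiv.Perm.mclosure_swap_castSucc_succ, top_le_iff] at key
    have : σ ∈ S := key ▸ Submonoid.mem_top σ
    exact this v

/-- The Taylor polynomial of order `n` of `f` at the origin. -/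
noncomputable def taylorPoly (f : V → Y) (n : ℕ) (x : V) : Y :=
  ∑ k ∈ Finset.range (n + 1), ((k.factorial : ℝ)⁻¹) • iteratedFDeriv ℝ k f 0 fun _ => x

theorem contDiff_taylorPoly (f : V → Y) (n : ℕ) {m : WithTop ℕ∞} :
    ContDiff ℝ m (taylorPoly f n) := by
  unfold taylorPoly
  refine ContDiff.sum fun k _ => ContDiff.const_smul _ ?_
  exact (ContinuousMultilinearMap.contDiff _).comp (contDiff_pi.2 fun _ => contDiff_id)

/-- The `k`-th derivative of a power series at its centre is its degree `k` term summed over all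
permutations of the arguments; by symmetry these `k!` summands agree and cancel the factor `1/k!`.
-/
theorem iteratedFDeriv_sub_taylorPoly {f : V → Y} {n : ℕ} (hf : ContDiff ℝ n f) {k : ℕ}
    (hk : k ≤ n) : iteratedFDeriv ℝ k (fun x => f x - taylorPoly f n x) 0 = 0 := by
  have hfk : ContDiff ℝ k f := hf.of_le (by exact_mod_cast hk)
  have h1 := iteratedFDeriv_sub_apply (i := k) hfk.contDiffAt
    (contDiff_taylorPoly f n).contDiffAt (x := (0 : V))
  let p : FormalMultilinearSeries ℝ V Y := fun k =>
    if k ≤ n then ((k.factorial : ℝ)⁻¹) • iteratedFDeriv ℝ k f 0 else 0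
  have hp : HasFiniteFPowerSeriesOnBall (taylorPoly f n) p 0 (n + 1) ⊤ := by
    refine HasFiniteFPowerSeriesOnBall.mk' (fun m hm => ?_) (by simp) fun y _ => ?_
    · simp [p, Nat.not_le.2 hm]
    · rw [zero_add, taylorPoly]
      refine Finset.sum_congr rfl fun k hk => ?_
      simp [p, Nat.lt_succ_iff.1 (Finset.mem_range.1 hk)]
  have h2 : iteratedFDeriv ℝ k (taylorPoly f n) 0 = iteratedFDeriv ℝ k f 0 := by
    ext v
    rw [hp.toHasFPowerSeriesOnBall.iteratedFDeriv_eq_sum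
      ((contDiff_taylorPoly f n).contDiffOn.analyticOn)]
    have h3 : ∀ σ : Equiv.Perm (Fin k), p k (fun i => v (σ i)) =
        ((k.factorial : ℝ)⁻¹) • iteratedFDeriv ℝ k f 0 v := by
      intro σ
      simp only [p, if_pos hk]
      rw [← iteratedFDeriv_comp_perm_of_contDiff hfk 0 v σ]
      rfl
    rw [Finset.sum_congr rfl fun σ _ => h3 σ, Finset.sum_const, Finset.card_univ,
      Fintype.card_perm, Fintype.card_fin, ← Nat.cast_smul_eq_nsmul ℝ, smul_smul,
      mul_inv_cancel₀ (by exact_mod_cast k.factorial_ne_zero), one_smul]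
  rw [h2, sub_self] at h1
  exact h1

/-- Linear symmetries of `f` pass to its Taylor polynomial; used for permutations of the coordinates
and for subtraction of the mean. -/
theorem taylorPoly_comp {f : V → Y} {n : ℕ} (hf : ContDiff ℝ n f) {q : V →L[ℝ] V}
    (hq : ∀ x, f (q x) = f x) (x : V) : taylorPoly f n (q x) = taylorPoly f n x := by
  unfold taylorPoly
  refine Finset.sum_congr rfl fun k hk => ?_
  have h1 := q.iteratedFDeriv_comp_right hf 0 (i := k)
    (by exact_mod_cast Nat.lt_succ_iff.1 (Finset.mem_range.1 hk))
  have h2 : f ∘ q = f := funext hq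
  rw [h2, map_zero] at h1
  conv_rhs => rw [h1]
  rfl

end Taylor

end MatrixFunctions

namespace MatrixFunctions

open Filter Topology Set
open scoped ContDiff

attribute [local instance] Matrix.linftyOpNormedRing Matrix.linftyOpNormedAlgebra

/-- The topology on square matrices that comes with the operator norm. -/
noncomputable abbrev matrixNormTopology {ι : Type} [Fintype ι] [DecidableEq ι] :
    TopologicalSpace (Matrix ι ι ℝ) :=
  (PseudoMetricSpace.toUniformSpace (α := Matrix ι ι ℝ)).toTopologicalSpace

attribute [local instance] matrixNormTopology

/-! ### Orthogonal conjugacy and smooth extension of symmetric polynomials -/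

section Invariants

variable {ι : Type} [Fintype ι] [DecidableEq ι]

/-- The symmetric part of a square matrix, as a linear map. -/
noncomputable def symPart : Matrix ι ι ℝ →L[ℝ] Matrix ι ι ℝ :=
  LinearMap.toContinuousLinearMap
    ((2⁻¹ : ℝ) • (LinearMap.id + (Matrix.transposeLinearEquiv ι ι ℝ ℝ).toLinearMap))

theorem symPart_apply (x : Matrix ι ι ℝ) : symPart x = (2⁻¹ : ℝ) • (x + x.transpose) := rfl

theorem symPart_transpose (x : Matrix ι ι ℝ) : (symPart x).transpose = symPart x := by
  simp [symPart_apply, add_comm]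

theorem symPart_of_isSymm {x : Matrix ι ι ℝ} (hx : x.transpose = x) : symPart x = x := by
  rw [symPart_apply, hx]; module

theorem symPart_symPart (x : Matrix ι ι ℝ) : symPart (symPart x) = symPart x :=
  symPart_of_isSymm (symPart_transpose x)

theorem symPart_diagonal (δ : ι → ℝ) :
    symPart (Matrix.diagonal δ) = Matrix.diagonal δ :=
  symPart_of_isSymm (Matrix.diagonal_transpose δ)

theorem symPart_mul_mul_transpose (U x : Matrix ι ι ℝ) :
    symPart (U * x * U.transpose) = U * symPart x * U.transpose := by
  simp [symPart_apply, Matrix.transpose_mul, Matrix.mul_add, Matrix.add_mul, Matrix.mul_assoc]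

/-- Two matrices are related if their symmetric parts are conjugate under an orthogonal matrix. -/
def OrthRel (x y : Matrix ι ι ℝ) : Prop :=
  ∃ U ∈ Matrix.orthogonalGroup ι ℝ, symPart y = U * symPart x * U.transpose

theorem mul_transpose_of_mem {U : Matrix ι ι ℝ} (hU : U ∈ Matrix.orthogonalGroup ι ℝ) :
    U * U.transpose = 1 := (Matrix.mem_orthogonalGroup_iff ι ℝ).1 hU

theorem transpose_mul_of_mem {U : Matrix ι ι ℝ} (hU : U ∈ Matrix.orthogonalGroup ι ℝ) :
    U.transpose * U = 1 := (Matrix.mem_orthogonalGroup_iff' ι ℝ).1 hU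

theorem transpose_mem {U : Matrix ι ι ℝ} (hU : U ∈ Matrix.orthogonalGroup ι ℝ) :
    U.transpose ∈ Matrix.orthogonalGroup ι ℝ := by
  rw [Matrix.mem_orthogonalGroup_iff]
  simpa using transpose_mul_of_mem hU

theorem orthRel_symPart (x : Matrix ι ι ℝ) : OrthRel x (symPart x) :=
  ⟨1, one_mem _, by simp [symPart_symPart]⟩

theorem OrthRel.smul {x y : Matrix ι ι ℝ} (h : OrthRel x y) (t : ℝ) :
    OrthRel (t • x) (t • y) := by
  obtain ⟨U, hU, h⟩ := h
  exact ⟨U, hU, by simp [h]⟩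

theorem exists_orthogonal_diagonal {x : Matrix ι ι ℝ} (hx : x.transpose = x) :
    ∃ U ∈ Matrix.orthogonalGroup ι ℝ, ∃ δ : ι → ℝ,
      x = U * Matrix.diagonal δ * U.transpose := by
  have h : x.IsHermitian := by simpa [Matrix.IsHermitian] using hx
  refine ⟨h.eigenvectorUnitary, h.eigenvectorUnitary.2, h.eigenvalues, ?_⟩
  have h1 := h.spectral_theorem
  rw [Unitary.conjStarAlgAut_apply] at h1
  exact h1

theorem exists_orthRel_diagonal (x : Matrix ι ι ℝ) :
    ∃ δ : ι → ℝ, OrthRel x (Matrix.diagonal δ) := by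
  obtain ⟨U, hU, δ, h⟩ := exists_orthogonal_diagonal (symPart_transpose x)
  refine ⟨δ, U.transpose, transpose_mem hU, ?_⟩
  rw [h, symPart_diagonal, Matrix.transpose_transpose]
  simp only [Matrix.mul_assoc, transpose_mul_of_mem hU, Matrix.mul_one]
  rw [← Matrix.mul_assoc, transpose_mul_of_mem hU, Matrix.one_mul]

theorem orthRel_diagonal_comp (δ : ι → ℝ) (σ : Equiv.Perm ι) :
    OrthRel (Matrix.diagonal δ) (Matrix.diagonal (δ ∘ σ)) := by
  refine ⟨σ.permMatrix ℝ, ?_, ?_⟩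
  · rw [Matrix.mem_orthogonalGroup_iff, Matrix.transpose_permMatrix, ← Matrix.permMatrix_mul]
    simp
  · rw [symPart_diagonal, symPart_diagonal]
    rw [Matrix.transpose_permMatrix, Equiv.Perm.permMatrix, Equiv.Perm.permMatrix,
      PEquiv.toMatrix_toPEquiv_mul, PEquiv.mul_toMatrix_toPEquiv, Matrix.submatrix_submatrix]
    exact (Matrix.submatrix_diagonal_equiv δ σ).symm

/-- `p` is the restriction to the diagonal matrices of a smooth invariant function. -/
def HasSmoothExtension (p : MvPolynomial ι ℝ) : Prop :=
  ∃ P : Matrix ι ι ℝ → ℝ, ContDiff ℝ ∞ P ∧ (∀ x y, OrthRel x y → P x = P y) ∧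
    ∀ δ : ι → ℝ, P (Matrix.diagonal δ) = MvPolynomial.eval δ p

theorem HasSmoothExtension.C (c : ℝ) : HasSmoothExtension (MvPolynomial.C (σ := ι) c) :=
  ⟨fun _ => c, contDiff_const, fun _ _ _ => rfl, fun _ => by simp⟩

theorem HasSmoothExtension.add {p q : MvPolynomial ι ℝ} (hp : HasSmoothExtension p)
    (hq : HasSmoothExtension q) : HasSmoothExtension (p + q) := by
  obtain ⟨P, h1, h2, h3⟩ := hp
  obtain ⟨Q, k1, k2, k3⟩ := hq
  exact ⟨fun x => P x + Q x, h1.add k1, fun x y h => by simp only [h2 x y h, k2 x y h],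
    fun δ => by simp [h3, k3]⟩

theorem HasSmoothExtension.mul {p q : MvPolynomial ι ℝ} (hp : HasSmoothExtension p)
    (hq : HasSmoothExtension q) : HasSmoothExtension (p * q) := by
  obtain ⟨P, h1, h2, h3⟩ := hp
  obtain ⟨Q, k1, k2, k3⟩ := hq
  exact ⟨fun x => P x * Q x, h1.mul k1, fun x y h => by simp only [h2 x y h, k2 x y h],
    fun δ => by simp [h3, k3]⟩

theorem HasSmoothExtension.sum {κ : Type*} {s : Finset κ} {p : κ → MvPolynomial ι ℝ}
    (hp : ∀ k ∈ s, HasSmoothExtension (p k)) : HasSmoothExtension (∑ k ∈ s, p k) := by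
  classical
  induction s using Finset.induction_on with
  | empty => simpa using HasSmoothExtension.C (ι := ι) 0
  | insert a s ha ih =>
    rw [Finset.sum_insert ha]
    exact (hp a (by simp)).add (ih fun k hk => hp k (by simp [hk]))

/-- The extension is the trace of the `k`-th power of the symmetric part. -/
theorem hasSmoothExtension_psum (k : ℕ) : HasSmoothExtension (MvPolynomial.psum ι ℝ k) := by
  refine ⟨fun x => Matrix.trace (symPart x ^ k), ?_, ?_, fun δ => ?_⟩
  · let T : Matrix ι ι ℝ →L[ℝ] ℝ := LinearMap.toContinuousLinearMap (Matrix.traceLinearMap ι ℝ ℝ)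
    have h1 : ContDiff ℝ ∞ fun x : Matrix ι ι ℝ => T (symPart x ^ k) := by fun_prop
    exact h1
  · rintro x y ⟨U, hU, h⟩
    have h1 : ∀ k : ℕ, (U * symPart x * U.transpose) ^ k = U * symPart x ^ k * U.transpose := by
      intro k
      induction k with
      | zero => simp [mul_transpose_of_mem hU]
      | succ k ih =>
        rw [pow_succ, ih, pow_succ]
        simp only [Matrix.mul_assoc]
        rw [← Matrix.mul_assoc U.transpose U, transpose_mul_of_mem hU, Matrix.one_mul]
    simp only [h, h1]
    rw [Matrix.trace_mul_comm, ← Matrix.mul_assoc, transpose_mul_of_mem hU, Matrix.one_mul]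
  · simp [symPart_diagonal, Matrix.diagonal_pow, Matrix.trace_diagonal, MvPolynomial.psum]

/-- Newton's identities express `k * esymm k` through power sums and lower `esymm`; over `ℝ` one may
divide by `k`. -/
theorem hasSmoothExtension_esymm (k : ℕ) : HasSmoothExtension (MvPolynomial.esymm ι ℝ k) := by
  induction k using Nat.strong_induction_on with
  | _ k ih =>
    rcases Nat.eq_zero_or_pos k with rfl | hk
    · simpa using HasSmoothExtension.C (ι := ι) 1
    have h1 := MvPolynomial.mul_esymm_eq_sum ι ℝ k
    have h2 : MvPolynomial.esymm ι ℝ k = MvPolynomial.C ((k : ℝ)⁻¹) *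
        ((k : MvPolynomial ι ℝ) * MvPolynomial.esymm ι ℝ k) := by
      rw [← mul_assoc, ← map_natCast (MvPolynomial.C (σ := ι) (R := ℝ)), ← map_mul,
        inv_mul_cancel₀ (by positivity), map_one, one_mul]
    have hs : ∀ m : ℕ, HasSmoothExtension ((-1 : MvPolynomial ι ℝ) ^ m) := fun m => by
      simpa using HasSmoothExtension.C (ι := ι) ((-1) ^ m)
    rw [h2, h1]
    refine (HasSmoothExtension.C _).mul ((hs _).mul (HasSmoothExtension.sum fun a ha => ?_))
    exact ((hs _).mul (ih _ (Finset.mem_filter.1 ha).2)).mul (hasSmoothExtension_psum _)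

theorem hasSmoothExtension_of_isSymmetric {p : MvPolynomial ι ℝ} (hp : p.IsSymmetric) :
    HasSmoothExtension p := by
  obtain ⟨q, hq⟩ := MvPolynomial.esymmAlgHom_surjective (σ := ι) ℝ (n := Fintype.card ι) le_rfl
    ⟨p, hp⟩
  have h1 : p = MvPolynomial.aeval (fun i : Fin (Fintype.card ι) =>
      MvPolynomial.esymm ι ℝ (i + 1)) q := by
    have := congrArg Subtype.val hq
    rw [MvPolynomial.esymmAlgHom_apply] at this
    exact this.symm
  rw [h1]
  clear h1 hq
  induction q using MvPolynomial.induction_on with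
  | C c => simpa using HasSmoothExtension.C (ι := ι) c
  | add p q hp hq => rw [map_add]; exact hp.add hq
  | mul_X p n hp =>
    rw [map_mul, MvPolynomial.aeval_X]
    exact hp.mul (hasSmoothExtension_esymm _)

/-- A permutation invariant polynomial function with vector coefficients is the restriction to the
diagonal matrices of a smooth invariant function. -/
theorem exists_smooth_extension_of_sum {Y : Type*} [NormedAddCommGroup Y] [NormedSpace ℝ Y]
    {κ : Type*} [Fintype κ] {g : (ι → ℝ) → Y} {m : κ → MvPolynomial ι ℝ} {c : κ → Y}
    (hg : ∀ δ, g δ = ∑ s, MvPolynomial.eval δ (m s) • c s)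
    (hσ : ∀ (σ : Equiv.Perm ι) δ, g (δ ∘ σ) = g δ) :
    ∃ P : Matrix ι ι ℝ → Y, ContDiff ℝ ∞ P ∧ (∀ x y, OrthRel x y → P x = P y) ∧
      ∀ δ : ι → ℝ, P (Matrix.diagonal δ) = g δ := by
  -- The individual `m s` need not be symmetric; averaging over permutations makes them so and
  -- leaves `g` unchanged.
  have h1 : ∀ s, HasSmoothExtension (∑ σ : Equiv.Perm ι, MvPolynomial.rename σ (m s)) := by
    intro s
    refine hasSmoothExtension_of_isSymmetric fun τ => ?_
    rw [map_sum]
    simp only [MvPolynomial.rename_rename]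
    exact Equiv.sum_comp (Equiv.mulLeft τ) fun σ : Equiv.Perm ι => MvPolynomial.rename σ (m s)
  choose P hP hP' hP'' using h1
  refine ⟨fun x => ((Fintype.card (Equiv.Perm ι) : ℝ)⁻¹) • ∑ s, P s x • c s, ?_, ?_, fun δ => ?_⟩
  · exact (ContDiff.sum fun s _ => (hP s).smul contDiff_const).const_smul _
  · intro x y h
    simp only [fun s => hP' s x y h]
  · have h2 : ∑ σ : Equiv.Perm ι, g (δ ∘ σ) = ∑ s, P s (Matrix.diagonal δ) • c s := by
      simp only [hg, hP'', map_sum, Finset.sum_smul, MvPolynomial.eval_rename]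
      exact Finset.sum_comm
    beta_reduce
    rw [← h2]
    simp only [hσ, Finset.sum_const, Finset.card_univ]
    rw [← Nat.cast_smul_eq_nsmul ℝ, smul_smul, inv_mul_cancel₀, one_smul]
    exact_mod_cast Fintype.card_ne_zero

/-- Expanding `δ` in the standard basis by multilinearity writes the Taylor polynomial as monomials
with coefficients in `Y`. -/
theorem exists_smooth_extension_taylorPoly {Y : Type*} [NormedAddCommGroup Y] [NormedSpace ℝ Y]
    {f : (ι → ℝ) → Y} {n : ℕ} (hf : ContDiff ℝ n f)
    (hσ : ∀ (σ : Equiv.Perm ι) δ, f (δ ∘ σ) = f δ) :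
    ∃ P : Matrix ι ι ℝ → Y, ContDiff ℝ ∞ P ∧ (∀ x y, OrthRel x y → P x = P y) ∧
      ∀ δ : ι → ℝ, P (Matrix.diagonal δ) = taylorPoly f n δ := by
  refine exists_smooth_extension_of_sum (κ := Σ k : Fin (n + 1), Fin k → ι)
    (m := fun s => ∏ j, MvPolynomial.X (s.2 j))
    (c := fun s => ((s.1 : ℕ).factorial : ℝ)⁻¹ •
      iteratedFDeriv ℝ s.1 f 0 fun j => Pi.single (s.2 j) 1) (fun δ => ?_) fun σ δ => ?_
  · rw [taylorPoly, Finset.sum_range, Fintype.sum_sigma]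
    refine Finset.sum_congr rfl fun k _ => ?_
    have h1 : δ = ∑ i, δ i • (Pi.single i 1 : ι → ℝ) := by
      ext j; simp [Finset.sum_apply, Pi.single_apply]
    have h2 : (iteratedFDeriv ℝ k f 0 fun _ => δ) = iteratedFDeriv ℝ k f 0
        fun _ => ∑ i, δ i • (Pi.single i 1 : ι → ℝ) := by rw [← h1]
    rw [h2, ContinuousMultilinearMap.map_sum, Finset.smul_sum]
    refine Finset.sum_congr rfl fun r _ => ?_
    rw [ContinuousMultilinearMap.map_smul_univ, smul_comm]
    simp
  · exact taylorPoly_comp hf (q := ContinuousLinearMap.pi fun i =>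
      ContinuousLinearMap.proj (R := ℝ) (φ := fun _ : ι => ℝ) (σ i)) (hσ σ) δ

end Invariants

end MatrixFunctions

namespace MatrixFunctions

open Filter Topology Set
open scoped ContDiff

set_option linter.unusedSectionVars false

attribute [local instance] Matrix.linftyOpNormedRing Matrix.linftyOpNormedAlgebra
attribute [local instance] matrixNormTopology

/-! ### Local block diagonalization near non-scalar matrices -/

section Blocks

universe u

variable {ι : Type} [Fintype ι] [DecidableEq ι]

theorem contDiff_linearMap {V W : Type*} [NormedAddCommGroup V] [NormedSpace ℝ V]
    [FiniteDimensional ℝ V] [NormedAddCommGroup W] [NormedSpace ℝ W] {n : WithTop ℕ∞}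
    (L : V →ₗ[ℝ] W) : ContDiff ℝ n L :=
  (LinearMap.toContinuousLinearMap L).contDiff

/-- The block diagonal matrix with given diagonal blocks. -/
def blockDiag (p : ι → Prop) [DecidablePred p] (y : Matrix {i // p i} {i // p i} ℝ)
    (z : Matrix {i // ¬p i} {i // ¬p i} ℝ) : Matrix ι ι ℝ :=
  (Matrix.fromBlocks y 0 0 z).submatrix (Equiv.sumCompl p).symm (Equiv.sumCompl p).symm

variable (p : ι → Prop) [DecidablePred p]

theorem blockDiag_mul (y y' : Matrix {i // p i} {i // p i} ℝ)
    (z z' : Matrix {i // ¬p i} {i // ¬p i} ℝ) :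
    blockDiag p y z * blockDiag p y' z' = blockDiag p (y * y') (z * z') := by
  simp [blockDiag, Matrix.submatrix_mul_equiv, Matrix.fromBlocks_multiply]

theorem blockDiag_transpose (y : Matrix {i // p i} {i // p i} ℝ)
    (z : Matrix {i // ¬p i} {i // ¬p i} ℝ) :
    (blockDiag p y z).transpose = blockDiag p y.transpose z.transpose := by
  simp [blockDiag, Matrix.fromBlocks_transpose]

theorem blockDiag_one : blockDiag p 1 1 = 1 := by
  simp [blockDiag, Matrix.fromBlocks_one]

theorem blockDiag_diagonal (δ : {i // p i} → ℝ) (w : {i // ¬p i} → ℝ) :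
    blockDiag p (Matrix.diagonal δ) (Matrix.diagonal w) =
      Matrix.diagonal (Sum.elim δ w ∘ (Equiv.sumCompl p).symm) := by
  rw [blockDiag, Matrix.fromBlocks_diagonal, Matrix.submatrix_diagonal_equiv]

theorem symPart_blockDiag (y : Matrix {i // p i} {i // p i} ℝ)
    (z : Matrix {i // ¬p i} {i // ¬p i} ℝ) :
    symPart (blockDiag p y z) = blockDiag p (symPart y) (symPart z) := by
  simp only [symPart_apply, blockDiag_transpose]
  ext i j
  simp only [blockDiag, Matrix.smul_apply, Matrix.add_apply, Matrix.submatrix_apply]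
  rcases (Equiv.sumCompl p).symm i with a | a <;> rcases (Equiv.sumCompl p).symm j with b | b <;>
    simp [mul_add]

theorem OrthRel.blockDiag {y y' : Matrix {i // p i} {i // p i} ℝ}
    {z z' : Matrix {i // ¬p i} {i // ¬p i} ℝ} (hy : OrthRel y y') (hz : OrthRel z z') :
    OrthRel (blockDiag p y z) (blockDiag p y' z') := by
  obtain ⟨U, hU, hy⟩ := hy
  obtain ⟨T, hT, hz⟩ := hz
  refine ⟨MatrixFunctions.blockDiag p U T, ?_, ?_⟩
  · rw [Matrix.mem_orthogonalGroup_iff, blockDiag_transpose, blockDiag_mul,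
      mul_transpose_of_mem hU, mul_transpose_of_mem hT, blockDiag_one]
  · simp only [symPart_blockDiag, blockDiag_transpose, blockDiag_mul, hy, hz]

theorem OrthRel.refl (x : Matrix ι ι ℝ) : OrthRel x x := ⟨1, one_mem _, by simp⟩

/-- The block diagonal part of a matrix. -/
def blockPart : Matrix ι ι ℝ →ₗ[ℝ] Matrix ι ι ℝ where
  toFun m := Matrix.of fun i j => if (p i ↔ p j) then m i j else 0
  map_add' x y := by ext i j; by_cases h : (p i ↔ p j) <;> simp [h]
  map_smul' c x := by ext i j; by_cases h : (p i ↔ p j) <;> simp [h]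

theorem blockPart_apply (m : Matrix ι ι ℝ) (i j : ι) :
    blockPart p m i j = if (p i ↔ p j) then m i j else 0 := rfl

theorem blockPart_eq_blockDiag (m : Matrix ι ι ℝ) :
    blockPart p m = blockDiag p (m.submatrix Subtype.val Subtype.val)
      (m.submatrix Subtype.val Subtype.val) := by
  ext i j
  rw [blockPart_apply]
  by_cases hi : p i <;> by_cases hj : p j <;>
    simp [blockDiag, hi, hj, Equiv.sumCompl_symm_apply_of_pos, Equiv.sumCompl_symm_apply_of_neg]

/-- If regularity is inherited from the diagonal for the diagonal blocks, then an invariant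
function is regular on block diagonal matrices. -/
theorem contDiff_comp_blockPart
    (hp : InheritsRegularity.{u} (Matrix.diagonal : ({i // p i} → ℝ) → _) OrthRel)
    (hq : InheritsRegularity.{u} (Matrix.diagonal : ({i // ¬p i} → ℝ) → _) OrthRel)
    {Y : Type u} [NormedAddCommGroup Y] [NormedSpace ℝ Y] {n : ℕ} {F : Matrix ι ι ℝ → Y}
    (hF : ∀ x y, OrthRel x y → F x = F y) (hf : ContDiff ℝ n (F ∘ Matrix.diagonal)) :
    ContDiff ℝ n fun m => F (blockPart p m) := by
  -- One block at a time: the diagonal of the second block is a parameter for the first, then the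
  -- whole first block is a parameter for the second.
  have h1 : ContDiff ℝ n fun q : Matrix {i // p i} {i // p i} ℝ × ({i // ¬p i} → ℝ) =>
      F (blockDiag p q.1 (Matrix.diagonal q.2)) := by
    refine hp.prod exists_orthRel_diagonal
      (fun x y w h => hF _ _ (h.blockDiag p (OrthRel.refl _))) ?_
    simp only [blockDiag_diagonal]
    refine hf.comp (contDiff_pi.2 fun i => ?_)
    simp only [Function.comp_apply]
    rcases (Equiv.sumCompl p).symm i with a | a <;> simp only [Sum.elim_inl, Sum.elim_inr] <;>
      fun_prop
  have h2 : ContDiff ℝ n fun q : Matrix {i // ¬p i} {i // ¬p i} ℝ ×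
      Matrix {i // p i} {i // p i} ℝ => F (blockDiag p q.2 q.1) :=
    hq.prod exists_orthRel_diagonal
      (fun x y w h => hF _ _ ((OrthRel.refl _).blockDiag p h))
      (h1.comp (contDiff_snd.prodMk contDiff_fst))
  simp only [blockPart_eq_blockDiag]
  let L₁ : Matrix ι ι ℝ →ₗ[ℝ] Matrix {i // p i} {i // p i} ℝ :=
    { toFun := fun m => m.submatrix Subtype.val Subtype.val
      map_add' := fun _ _ => rfl
      map_smul' := fun _ _ => rfl }
  let L₂ : Matrix ι ι ℝ →ₗ[ℝ] Matrix {i // ¬p i} {i // ¬p i} ℝ :=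
    { toFun := fun m => m.submatrix Subtype.val Subtype.val
      map_add' := fun _ _ => rfl
      map_smul' := fun _ _ => rfl }
  exact h2.comp ((contDiff_linearMap L₂).prodMk (contDiff_linearMap L₁))

/-- The skew-symmetric matrix built from the off-diagonal blocks of the symmetric part. -/
noncomputable def skewGen : Matrix ι ι ℝ →ₗ[ℝ] Matrix ι ι ℝ where
  toFun m := Matrix.of fun i j =>
    ((if p j then 1 else 0) - if p i then 1 else 0) * (m i j + m j i)
  map_add' x y := by ext i j; simp; ring
  map_smul' c x := by ext i j; simp; ring

theorem skewGen_apply (m : Matrix ι ι ℝ) (i j : ι) : skewGen p m i j =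
    ((if p j then 1 else 0) - if p i then 1 else 0) * (m i j + m j i) := rfl

theorem skewGen_transpose (m : Matrix ι ι ℝ) : (skewGen p m).transpose = -skewGen p m := by
  ext i j
  rw [Matrix.transpose_apply, Matrix.neg_apply, skewGen_apply, skewGen_apply]
  ring

/-- The skew-symmetric part of the off-diagonal blocks. -/
noncomputable def offSkewPart : Matrix ι ι ℝ →ₗ[ℝ] Matrix ι ι ℝ where
  toFun m := Matrix.of fun i j => if (p i ↔ p j) then 0 else m i j - m j i
  map_add' x y := by ext i j; by_cases h : (p i ↔ p j) <;> simp [h]; ring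
  map_smul' c x := by ext i j; by_cases h : (p i ↔ p j) <;> simp [h]; ring

theorem offSkewPart_apply (m : Matrix ι ι ℝ) (i j : ι) :
    offSkewPart p m i j = if (p i ↔ p j) then 0 else m i j - m j i := rfl

theorem symPart_offSkewPart (m : Matrix ι ι ℝ) : symPart (offSkewPart p m) = 0 := by
  have h : (offSkewPart p m).transpose = -offSkewPart p m := by
    ext i j
    rw [Matrix.transpose_apply, Matrix.neg_apply, offSkewPart_apply, offSkewPart_apply]
    by_cases h : (p i ↔ p j)
    · simp [h]
    · simp [h, show ¬(p j ↔ p i) from fun h' => h h'.symm]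
  rw [symPart_apply, h]; simp

/-- A local chart of the space of matrices that is adapted to block diagonalization. -/
noncomputable def blockChart (m : Matrix ι ι ℝ) : Matrix ι ι ℝ :=
  NormedSpace.exp (skewGen p m) * blockPart p m * NormedSpace.exp (-skewGen p m) +
    offSkewPart p m

theorem exp_skewGen_transpose (m : Matrix ι ι ℝ) :
    (NormedSpace.exp (skewGen p m)).transpose = NormedSpace.exp (-skewGen p m) := by
  rw [← skewGen_transpose]
  exact (Matrix.exp_transpose _).symm

/-- The exponential of a skew matrix is orthogonal, and the extra skew summand of the chart is
invisible to the symmetric part. -/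
theorem orthRel_blockChart (m : Matrix ι ι ℝ) : OrthRel (blockPart p m) (blockChart p m) := by
  refine ⟨NormedSpace.exp (skewGen p m), ?_, ?_⟩
  · rw [Matrix.mem_orthogonalGroup_iff, exp_skewGen_transpose,
      ← NormedSpace.exp_add_of_commute (Commute.neg_right (Commute.refl _)), add_neg_cancel,
      NormedSpace.exp_zero]
  · rw [blockChart, map_add, symPart_offSkewPart, add_zero, ← exp_skewGen_transpose,
      symPart_mul_mul_transpose]

theorem contDiff_blockChart {n : WithTop ℕ∞} :
    ContDiff ℝ n (blockChart p : Matrix ι ι ℝ → Matrix ι ι ℝ) := by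
  have h1 : ContDiff ℝ n (NormedSpace.exp : Matrix ι ι ℝ → Matrix ι ι ℝ) :=
    AnalyticOnNhd.contDiff fun x _ => NormedSpace.exp_analytic (𝕂 := ℝ) x
  have h2 : ContDiff ℝ n (skewGen p : Matrix ι ι ℝ → Matrix ι ι ℝ) := contDiff_linearMap _
  have h3 : ContDiff ℝ n (blockPart p : Matrix ι ι ℝ → Matrix ι ι ℝ) := contDiff_linearMap _
  have h4 : ContDiff ℝ n (offSkewPart p : Matrix ι ι ℝ → Matrix ι ι ℝ) := contDiff_linearMap _
  exact (((h1.comp h2).mul h3).mul (h1.comp h2.neg)).add h4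

theorem blockPart_diagonal (δ : ι → ℝ) :
    blockPart p (Matrix.diagonal δ) = Matrix.diagonal δ := by
  ext i j
  rw [blockPart_apply]
  by_cases h : i = j
  · simp [h]
  · simp [h]

theorem skewGen_diagonal (δ : ι → ℝ) : skewGen p (Matrix.diagonal δ) = 0 := by
  ext i j
  rw [skewGen_apply]
  by_cases h : i = j
  · simp [h]
  · simp [h, Ne.symm h]

theorem offSkewPart_diagonal (δ : ι → ℝ) : offSkewPart p (Matrix.diagonal δ) = 0 := by
  ext i j
  rw [offSkewPart_apply]
  by_cases h : i = j
  · simp [h]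
  · simp [h, Ne.symm h]

theorem blockChart_diagonal (δ : ι → ℝ) :
    blockChart p (Matrix.diagonal δ) = Matrix.diagonal δ := by
  simp [blockChart, skewGen_diagonal, blockPart_diagonal, offSkewPart_diagonal]

/-- The derivative of `blockChart` at a diagonal matrix. -/
noncomputable def blockChartDeriv (δ : ι → ℝ) : Matrix ι ι ℝ →ₗ[ℝ] Matrix ι ι ℝ where
  toFun h := skewGen p h * Matrix.diagonal δ - Matrix.diagonal δ * skewGen p h + blockPart p h +
    offSkewPart p h
  map_add' x y := by simp only [map_add, Matrix.add_mul, Matrix.mul_add]; abel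
  map_smul' c x := by simp [smul_sub]

theorem hasFDerivAt_blockChart (δ : ι → ℝ) :
    HasFDerivAt (blockChart p) (LinearMap.toContinuousLinearMap (blockChartDeriv p δ))
      (Matrix.diagonal δ) := by
  have h0 : HasFDerivAt (NormedSpace.exp : Matrix ι ι ℝ → Matrix ι ι ℝ)
      (1 : Matrix ι ι ℝ →L[ℝ] Matrix ι ι ℝ) 0 := hasFDerivAt_exp_zero
  let A := LinearMap.toContinuousLinearMap (skewGen p : Matrix ι ι ℝ →ₗ[ℝ] Matrix ι ι ℝ)
  let B := LinearMap.toContinuousLinearMap (blockPart p : Matrix ι ι ℝ →ₗ[ℝ] Matrix ι ι ℝ)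
  let R := LinearMap.toContinuousLinearMap (offSkewPart p : Matrix ι ι ℝ →ₗ[ℝ] Matrix ι ι ℝ)
  have hA : A (Matrix.diagonal δ) = 0 := skewGen_diagonal p δ
  have h1 : HasFDerivAt (fun m => NormedSpace.exp (A m)) A (Matrix.diagonal δ) := by
    have := HasFDerivAt.comp (Matrix.diagonal δ) (g := NormedSpace.exp) (by rw [hA]; exact h0)
      A.hasFDerivAt
    exact this.congr_fderiv (by ext1 x; rfl)
  have h2 : HasFDerivAt (fun m => NormedSpace.exp (-A m)) (-A) (Matrix.diagonal δ) := by
    have := HasFDerivAt.comp (Matrix.diagonal δ) (g := NormedSpace.exp)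
      (by rw [Pi.neg_apply, hA, neg_zero]; exact h0) A.hasFDerivAt.neg
    exact this.congr_fderiv (by ext1 x; rfl)
  have h3 := ((h1.mul' B.hasFDerivAt).mul' h2).add R.hasFDerivAt
  refine (h3.congr_fderiv ?_)
  ext1 h
  have hB : B (Matrix.diagonal δ) = Matrix.diagonal δ := blockPart_diagonal p δ
  have hd : LinearMap.toContinuousLinearMap (blockChartDeriv p δ) h =
    A h * Matrix.diagonal δ - Matrix.diagonal δ * A h + B h + R h := rfl
  rw [hd]
  simp only [Pi.mul_apply, hA, hB, neg_zero, NormedSpace.exp_zero, one_mul, add_apply,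
    smul_apply, neg_apply,
    smul_eq_mul, MulOpposite.op_one, one_smul, MulOpposite.smul_eq_mul_unop, MulOpposite.unop_op]
  noncomm_ring

/-- Diagonal blocks are left unchanged. Off them the commutator contributes the symmetric term `(δ i
- δ j) * (h i j + h j i)` for `p i`, `¬p j`, and `offSkewPart` the skew term, so the two vanish
separately. -/
theorem blockChartDeriv_injective {δ : ι → ℝ} (hδ : ∀ i j, p i → ¬p j → δ i ≠ δ j) :
    Function.Injective (blockChartDeriv p δ) := by
  rw [injective_iff_map_eq_zero]
  intro h hh
  have hij : ∀ i j, skewGen p h i j * δ j - δ i * skewGen p h i j + blockPart p h i j +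
      offSkewPart p h i j = 0 := by
    intro i j
    have := congrFun (congrFun hh i) j
    simpa [blockChartDeriv, Matrix.mul_diagonal, Matrix.diagonal_mul] using this
  have hne : ∀ i j, p i → ¬p j → h i j = 0 ∧ h j i = 0 := by
    intro i j hi hj
    have h1 := hij i j
    have h2 := hij j i
    simp only [skewGen_apply, blockPart_apply, offSkewPart_apply, hi, hj] at h1 h2
    norm_num at h1 h2
    have h3 : (δ i - δ j) * (h i j + h j i) = 0 := by linarith
    have h4 : h i j + h j i = 0 := by
      rcases mul_eq_zero.1 h3 with h4 | h4
      · exact absurd (sub_eq_zero.1 h4) (hδ i j hi hj)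
      · exact h4
    have h5 : h j i = -h i j := by linarith
    rw [h5] at h1
    constructor <;> nlinarith
  ext i j
  by_cases hi : p i <;> by_cases hj : p j
  · simpa [skewGen_apply, blockPart_apply, offSkewPart_apply, hi, hj] using hij i j
  · exact (hne i j hi hj).1
  · exact (hne j i hj hi).2
  · simpa [skewGen_apply, blockPart_apply, offSkewPart_apply, hi, hj] using hij i j

/-- By the inverse function theorem nearby matrices are `blockChart p m` with `m` smooth in the
matrix, and invariance replaces the chart by `blockPart p m`. -/
theorem contDiffAt_diagonal {δ : ι → ℝ} (hδ : ∀ i j, p i → ¬p j → δ i ≠ δ j) {Y : Type*}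
    [NormedAddCommGroup Y] [NormedSpace ℝ Y] {n : ℕ} {F : Matrix ι ι ℝ → Y}
    (hF : ∀ x y, OrthRel x y → F x = F y) (hf : ContDiff ℝ n fun m => F (blockPart p m)) :
    ContDiffAt ℝ n F (Matrix.diagonal δ) := by
  let e : Matrix ι ι ℝ ≃L[ℝ] Matrix ι ι ℝ := (LinearEquiv.ofInjectiveEndo _
    (blockChartDeriv_injective p hδ)).toContinuousLinearEquiv
  have h1 : HasFDerivAt (blockChart p) (e : Matrix ι ι ℝ →L[ℝ] Matrix ι ι ℝ)
      (Matrix.diagonal δ) := hasFDerivAt_blockChart p δ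
  have h2 : ContDiffAt ℝ ∞ (blockChart p) (Matrix.diagonal δ) := (contDiff_blockChart p).contDiffAt
  have h3 := h2.to_localInverse h1 (by simp)
  have h4 := (h2.hasStrictFDerivAt' h1 (by simp)).eventually_right_inverse
  rw [blockChart_diagonal] at h3 h4
  have h5 : ContDiffAt ℝ n ((fun m => F (blockPart p m)) ∘ h2.localInverse h1 (by simp))
      (Matrix.diagonal δ) :=
    hf.contDiffAt.comp _ (h3.of_le (by exact_mod_cast le_top))
  refine h5.congr_of_eventuallyEq ?_
  filter_upwards [h4] with x hx
  have h6 := hF _ _ (orthRel_blockChart p (h2.localInverse h1 (by simp) x))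
  exact (congrArg F hx.symm).trans h6.symm

/-- An invariant function is regular away from the matrices with scalar symmetric part, if
regularity is inherited from the diagonal for smaller matrices. -/
theorem contDiffAt_of_nonscalar
    (IH : ∀ (κ : Type) [Fintype κ] [DecidableEq κ], Fintype.card κ < Fintype.card ι →
      InheritsRegularity.{u} (Matrix.diagonal : (κ → ℝ) → Matrix κ κ ℝ) OrthRel)
    {Y : Type u} [NormedAddCommGroup Y] [NormedSpace ℝ Y] {n : ℕ} {F : Matrix ι ι ℝ → Y}
    (hF : ∀ x y, OrthRel x y → F x = F y) (hf : ContDiff ℝ n (F ∘ Matrix.diagonal))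
    {x : Matrix ι ι ℝ} (hx : ∀ c : ℝ, symPart x ≠ c • (1 : Matrix ι ι ℝ)) :
    ContDiffAt ℝ n F x := by
  classical
  obtain ⟨U, hU, δ, hUδ⟩ := exists_orthogonal_diagonal (symPart_transpose x)
  have hδ : ∃ i j, δ i ≠ δ j := by
    by_contra! h
    rcases isEmpty_or_nonempty ι with hι | ⟨⟨i₀⟩⟩
    · exact hx 0 (Subsingleton.elim _ _)
    · refine hx (δ i₀) ?_
      have : Matrix.diagonal δ = δ i₀ • (1 : Matrix ι ι ℝ) := by
        rw [Matrix.smul_one_eq_diagonal]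
        congr 1; funext i; exact h i i₀
      rw [hUδ, this]
      simp [mul_transpose_of_mem hU]
  obtain ⟨i₀, j₀, hij⟩ := hδ
  -- One eigenvalue against all others: `i₀` and `j₀` lie in different groups, so both blocks are
  -- strictly smaller.
  let p : ι → Prop := fun i => δ i = δ i₀
  have hpδ : ∀ i j, p i → ¬p j → δ i ≠ δ j := fun i j hi hj h => hj (h.symm.trans hi)
  have h1 := contDiff_comp_blockPart p
    (IH _ (Fintype.card_subtype_lt (x := j₀) (fun h : p j₀ => hij h.symm)))
    (IH _ (Fintype.card_subtype_lt (x := i₀) (fun h : ¬p i₀ => h rfl))) hF hf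
  have h2 := contDiffAt_diagonal p hpδ hF h1
  let L : Matrix ι ι ℝ →ₗ[ℝ] Matrix ι ι ℝ :=
    { toFun := fun m => U.transpose * symPart m * U
      map_add' := fun a b => by rw [map_add, Matrix.mul_add, Matrix.add_mul]
      map_smul' := fun c a => by simp }
  have h3 : L x = Matrix.diagonal δ := by
    show U.transpose * symPart x * U = _
    rw [hUδ]
    simp only [Matrix.mul_assoc, transpose_mul_of_mem hU, Matrix.mul_one]
    rw [← Matrix.mul_assoc, transpose_mul_of_mem hU, Matrix.one_mul]
  have h4 : F = F ∘ L := by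
    funext m
    refine hF _ _ ⟨U.transpose, transpose_mem hU, ?_⟩
    have := symPart_mul_mul_transpose U.transpose (symPart m)
    rw [symPart_symPart, Matrix.transpose_transpose] at this
    rw [Matrix.transpose_transpose]
    exact this
  rw [h4]
  refine ContDiffAt.comp x ?_ (contDiff_linearMap L).contDiffAt
  rw [h3]
  exact h2

end Blocks

end MatrixFunctions

namespace MatrixFunctions

open Filter Topology Set
open scoped ContDiff

set_option linter.unusedSectionVars false

attribute [local instance] Matrix.linftyOpNormedRing Matrix.linftyOpNormedAlgebra
attribute [local instance] matrixNormTopology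

/-! ### The origin of the trace-free space and the induction on size -/

section Traceless

universe u

variable {ι : Type} [Fintype ι] [DecidableEq ι]

/-- The trace-free part of the symmetric part of a matrix. -/
noncomputable def tracelessPart : Matrix ι ι ℝ →ₗ[ℝ] Matrix ι ι ℝ where
  toFun x := symPart x - (x.trace / Fintype.card ι) • (1 : Matrix ι ι ℝ)
  map_add' x y := by rw [map_add, Matrix.trace_add, add_div, add_smul]; abel
  map_smul' c x := by
    rw [map_smul, Matrix.trace_smul, RingHom.id_apply, smul_sub, smul_smul, smul_eq_mul,
      mul_div_assoc]

theorem tracelessPart_apply (x : Matrix ι ι ℝ) :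
    tracelessPart x = symPart x - (x.trace / Fintype.card ι) • (1 : Matrix ι ι ℝ) := rfl

theorem trace_symPart (x : Matrix ι ι ℝ) : (symPart x).trace = x.trace := by
  rw [symPart_apply, Matrix.trace_smul, Matrix.trace_add, Matrix.trace_transpose, smul_eq_mul]
  ring

theorem symPart_smul_one (c : ℝ) : symPart (c • (1 : Matrix ι ι ℝ)) = c • 1 :=
  symPart_of_isSymm (by simp)

theorem symPart_tracelessPart (x : Matrix ι ι ℝ) :
    symPart (tracelessPart x) = tracelessPart x := by
  rw [tracelessPart_apply, map_sub, symPart_symPart, symPart_smul_one]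

theorem trace_tracelessPart (x : Matrix ι ι ℝ) : (tracelessPart x).trace = 0 := by
  rw [tracelessPart_apply, Matrix.trace_sub, trace_symPart, Matrix.trace_smul, Matrix.trace_one,
    smul_eq_mul]
  rcases isEmpty_or_nonempty ι with h | h
  · simp [Matrix.trace]
  · rw [div_mul_cancel₀ _ (by exact_mod_cast Fintype.card_ne_zero), sub_self]

theorem tracelessPart_tracelessPart (x : Matrix ι ι ℝ) :
    tracelessPart (tracelessPart x) = tracelessPart x := by
  conv_lhs => rw [tracelessPart_apply]
  rw [symPart_tracelessPart, trace_tracelessPart]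
  simp

theorem tracelessPart_eq_zero_of_eq_smul_one {x : Matrix ι ι ℝ} {c : ℝ}
    (h : tracelessPart x = c • (1 : Matrix ι ι ℝ)) : tracelessPart x = 0 := by
  have h1 := trace_tracelessPart x
  rw [h, Matrix.trace_smul, Matrix.trace_one, smul_eq_mul, mul_eq_zero] at h1
  rcases h1 with h1 | h1
  · rw [h, h1, zero_smul]
  · have : IsEmpty ι := Fintype.card_eq_zero_iff.1 (by exact_mod_cast h1)
    exact Subsingleton.elim _ _

theorem OrthRel.trace_eq {x y : Matrix ι ι ℝ} (h : OrthRel x y) : x.trace = y.trace := by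
  obtain ⟨U, hU, h⟩ := h
  rw [← trace_symPart x, ← trace_symPart y, h, Matrix.trace_mul_comm, ← Matrix.mul_assoc,
    transpose_mul_of_mem hU, Matrix.one_mul]

theorem OrthRel.tracelessPart_add {x y : Matrix ι ι ℝ} (h : OrthRel x y) (s : ℝ) :
    OrthRel (tracelessPart x + s • 1) (tracelessPart y + s • 1) := by
  have ht := h.trace_eq
  obtain ⟨U, hU, h⟩ := h
  refine ⟨U, hU, ?_⟩
  rw [map_add, map_add, symPart_tracelessPart, symPart_tracelessPart, symPart_smul_one,
    tracelessPart_apply, tracelessPart_apply, h, ht]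
  simp [Matrix.mul_add, Matrix.add_mul, Matrix.mul_sub, Matrix.sub_mul, mul_transpose_of_mem hU]

theorem OrthRel.tracelessPart {x y : Matrix ι ι ℝ} (h : OrthRel x y) :
    OrthRel (tracelessPart x) (tracelessPart y) := by
  simpa using h.tracelessPart_add 0

/-- Subtraction of the mean value. -/
noncomputable def meanFree : (ι → ℝ) →ₗ[ℝ] (ι → ℝ) where
  toFun δ i := δ i - (∑ j, δ j) / Fintype.card ι
  map_add' x y := by ext i; simp [Finset.sum_add_distrib, add_div]; ring
  map_smul' c x := by ext i; simp [← Finset.mul_sum, mul_div_assoc]; ring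

theorem tracelessPart_diagonal (δ : ι → ℝ) :
    tracelessPart (Matrix.diagonal δ) = Matrix.diagonal (meanFree δ) := by
  rw [tracelessPart_apply, symPart_diagonal, Matrix.trace_diagonal, Matrix.smul_one_eq_diagonal,
    Matrix.diagonal_sub]
  rfl

/-- Ignoring the trace makes the origin the only singular point, where Taylor subtraction and
rescaling apply. -/
theorem contDiff_of_tracelessPart
    (IH : ∀ (κ : Type) [Fintype κ] [DecidableEq κ], Fintype.card κ < Fintype.card ι →
      InheritsRegularity.{u} (Matrix.diagonal : (κ → ℝ) → Matrix κ κ ℝ) OrthRel)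
    {Y : Type u} [NormedAddCommGroup Y] [NormedSpace ℝ Y] {n : ℕ} {F : Matrix ι ι ℝ → Y}
    (hF : ∀ x y, OrthRel x y → F x = F y) (hFt : ∀ x, F (tracelessPart x) = F x)
    (hf : ContDiff ℝ n (F ∘ Matrix.diagonal)) : ContDiff ℝ n F := by
  set f : (ι → ℝ) → Y := F ∘ Matrix.diagonal with hfdef
  obtain ⟨P, hP, hPinv, hPf⟩ := exists_smooth_extension_taylorPoly hf
    fun σ δ => (hF _ _ (orthRel_diagonal_comp δ σ)).symm
  choose ρ hρ using exists_orthRel_diagonal (ι := ι)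
  have hPt : ∀ x, P (tracelessPart x) = P x := by
    intro x
    rw [hPinv _ _ (hρ x).tracelessPart, hPinv _ _ (hρ x), tracelessPart_diagonal, hPf, hPf]
    refine taylorPoly_comp hf (q := LinearMap.toContinuousLinearMap meanFree) (fun δ => ?_) (ρ x)
    have := hFt (Matrix.diagonal δ)
    rw [tracelessPart_diagonal] at this
    exact this
  let G : Matrix ι ι ℝ → Y := fun x => F x - P x
  have hG : ∀ x y, OrthRel x y → G x = G y := fun x y h => by
    simp only [G, hF x y h, hPinv x y h]
  have hGt : ∀ x, G (tracelessPart x) = G x := fun x => by simp only [G, hFt, hPt]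
  have hGf : ∀ δ, G (Matrix.diagonal δ) = f δ - taylorPoly f n δ := fun δ => by
    simp only [G, hPf, hfdef, Function.comp_apply]
  suffices h : ContDiff ℝ n G by
    have h1 : F = fun x => G x + P x := by funext x; simp [G]
    rw [h1]
    exact h.add (hP.of_le (by exact_mod_cast le_top))
  obtain ⟨w, hw, hw'⟩ := exists_contDiff_rescale (f := fun δ => f δ - taylorPoly f n δ)
    (hf.sub (contDiff_taylorPoly f n)) fun k hk => iteratedFDeriv_sub_taylorPoly hf hk
  -- Continuity in `t` is known only on the diagonal; a diagonal representative of `x` transports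
  -- it, and the result does not depend on the representative.
  let u : Matrix ι ι ℝ → C(Icc (0 : ℝ) 1, Y) := fun x => w (ρ x)
  have hu : ∀ x t, u x t = ((t : ℝ) ^ n)⁻¹ • G ((t : ℝ) • x) := by
    intro x t
    rw [hG _ _ ((hρ x).smul t), ← Matrix.diagonal_smul, hGf]
    exact hw' _ _
  have hu1 : ∀ x y, OrthRel x y → u x = u y := by
    intro x y h
    ext t
    rw [hu, hu, hG _ _ (h.smul t)]
  have hu2 : u ∘ Matrix.diagonal = w := by
    funext δ
    ext t
    rw [Function.comp_apply, hu, hw', ← Matrix.diagonal_smul, hGf]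
  have hu3 : ∀ x : Matrix ι ι ℝ, (∀ c : ℝ, symPart x ≠ c • (1 : Matrix ι ι ℝ)) →
      ContDiffAt ℝ n u x := fun x hx =>
    contDiffAt_of_nonscalar IH hu1 (by rw [hu2]; exact hw) hx
  -- A scalar matrix in this space is 0, so `u` is `C^n` along it away from the origin.
  let S := LinearMap.range (tracelessPart (ι := ι))
  let e := (Module.finBasis ℝ S).equivFun
  let L : (Fin (Module.finrank ℝ S) → ℝ) →ₗ[ℝ] Matrix ι ι ℝ := S.subtype ∘ₗ e.symm.toLinearMap
  let M : Matrix ι ι ℝ →ₗ[ℝ] (Fin (Module.finrank ℝ S) → ℝ) :=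
    e.toLinearMap ∘ₗ tracelessPart.rangeRestrict
  have hLM : ∀ x, L (M x) = tracelessPart x := fun x => by simp [L, M]
  have hL : ∀ y, ∃ x, L y = tracelessPart x := fun y => by
    obtain ⟨x, hx⟩ := (e.symm y).2
    exact ⟨x, hx.symm⟩
  have hL0 : ∀ y, L y = 0 → y = 0 := fun y hy => by simpa [L] using hy
  have hGL : ContDiff ℝ n (G ∘ L) := by
    refine contDiff_of_rescale (u := u ∘ L) ?_ (fun y hy => ?_) fun y _ t => ?_
    · rw [Function.comp_apply, map_zero, ← Matrix.diagonal_zero, hGf]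
      have := iteratedFDeriv_sub_taylorPoly hf (Nat.zero_le n)
      rw [← norm_eq_zero, norm_iteratedFDeriv_zero, norm_eq_zero] at this
      exact this
    · refine ((hu3 (L y) fun c hc => hy (hL0 y ?_)).comp y
        (contDiff_linearMap L).contDiffAt).contDiffWithinAt
      obtain ⟨x, hx⟩ := hL y
      rw [hx, symPart_tracelessPart] at hc
      rw [hx]
      exact tracelessPart_eq_zero_of_eq_smul_one hc
    · simp [hu]
  have hGM : G = (G ∘ L) ∘ M := by
    funext x
    simp only [Function.comp_apply, hLM, hGt]
  rw [hGM]
  exact hGL.comp (contDiff_linearMap M)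

/-- Functions of matrices that are invariant under orthogonal conjugation of the symmetric part
inherit their regularity from the diagonal matrices. -/
theorem inheritsRegularity_diagonal (ι : Type) [Fintype ι] [DecidableEq ι] :
    InheritsRegularity.{u} (Matrix.diagonal : (ι → ℝ) → Matrix ι ι ℝ) OrthRel := by
  induction hd : Fintype.card ι using Nat.strong_induction_on generalizing ι with
  | _ d ih =>
    have IH : ∀ (κ : Type) [Fintype κ] [DecidableEq κ], Fintype.card κ < Fintype.card ι →
        InheritsRegularity.{u} (Matrix.diagonal : (κ → ℝ) → Matrix κ κ ℝ) OrthRel :=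
      fun κ _ _ hκ => ih _ (hd ▸ hκ) κ rfl
    -- Enlarging the relation encodes independence of the trace as an invariance, so that
    -- `InheritsRegularity.prod` can restore the trace as a parameter.
    have H : InheritsRegularity.{u} (Matrix.diagonal : (ι → ℝ) → Matrix ι ι ℝ)
        fun x y => OrthRel x y ∨ y = tracelessPart x := by
      intro Y _ _ n F hF hf
      exact contDiff_of_tracelessPart IH (fun x y h => hF x y (Or.inl h))
        (fun x => (hF x _ (Or.inr rfl)).symm) hf
    intro Y _ _ n F hF hf
    have h1 : ContDiff ℝ n fun q : Matrix ι ι ℝ × ℝ =>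
        F (tracelessPart q.1 + q.2 • (1 : Matrix ι ι ℝ)) := by
      refine H.prod (fun x => (exists_orthRel_diagonal x).imp fun δ h => Or.inl h) ?_ ?_
      · rintro x y s (h | rfl)
        · exact hF _ _ (h.tracelessPart_add s)
        · simp only [tracelessPart_tracelessPart]
      · simp only [tracelessPart_diagonal, Matrix.smul_one_eq_diagonal, Matrix.diagonal_add]
        refine hf.comp (contDiff_pi.2 fun i => ?_)
        have h2 : ContDiff ℝ n (meanFree : (ι → ℝ) → ι → ℝ) := contDiff_linearMap _
        exact ((contDiff_apply ℝ ℝ i).comp (h2.comp contDiff_fst)).add contDiff_snd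
    have h2 : F = fun x => F (tracelessPart x +
        (((Fintype.card ι : ℝ)⁻¹ • Matrix.traceLinearMap ι ℝ ℝ) x) • (1 : Matrix ι ι ℝ)) := by
      funext x
      rw [hF _ _ (orthRel_symPart x), tracelessPart_apply]
      congr 1
      rw [LinearMap.smul_apply, Matrix.traceLinearMap_apply, smul_eq_mul, div_eq_inv_mul,
        sub_add_cancel]
    rw [h2]
    exact h1.comp (contDiff_id.prodMk
      (contDiff_linearMap ((Fintype.card ι : ℝ)⁻¹ • Matrix.traceLinearMap ι ℝ ℝ)))

end Traceless

end MatrixFunctions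

namespace MatrixFunctions

open Filter Topology Set
open scoped ContDiff

set_option linter.unusedSectionVars false

/-! ### Iterated directional derivatives versus maps into function spaces -/

section FirstVariable

theorem IsCFst.comp_fst {A A' B : Type*} [AddCommGroup A] [Module ℝ A] [TopologicalSpace A]
    [AddCommGroup A'] [Module ℝ A'] [TopologicalSpace A'] [AddCommGroup B] [Module ℝ B]
    [TopologicalSpace B] {n : ℕ} {F : A × B → ℝ} (hF : IsCFst n F) (L : A' →ₗ[ℝ] A)
    (hL : Continuous L) : IsCFst n fun p : A' × B => F (L p.1, p.2) := by
  induction n generalizing F with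
  | zero =>
    have hF : Continuous F := hF
    show Continuous _
    fun_prop
  | succ n ih =>
    obtain ⟨hc, hd⟩ := hF
    have key : ∀ (a : A') (p : A' × B) (t : ℝ), F (L (p + t • (a, (0 : B))).1,
        (p + t • (a, (0 : B))).2) = F ((L p.1, p.2) + t • (L a, 0)) := fun a p t => by simp
    refine ⟨by fun_prop, fun a => ⟨fun p => ?_, ?_⟩⟩
    · have := (hd (L a)).1 (L p.1, p.2)
      unfold LineDifferentiableAt at this ⊢
      simpa only [key] using this
    · have := ih (hd (L a)).2
      unfold lineDeriv at this ⊢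
      simpa only [key] using this

variable {V E : Type*} [NormedAddCommGroup V] [NormedSpace ℝ V]
  [NormedAddCommGroup E] [NormedSpace ℝ E] [ProperSpace E]

theorem IsCFst.contDiffFst [FiniteDimensional ℝ V] {n : ℕ} {F : V × E → ℝ} (hF : IsCFst n F) :
    ContDiffFst n F := by
  intro R
  induction n generalizing F with
  | zero =>
    have hc : Continuous F := hF
    let c : C(V × Metric.closedBall (0 : E) R, ℝ) := ⟨fun p => F (p.1, p.2), by fun_prop⟩
    exact ⟨c.curry, by simpa using c.curry.continuous, fun x k => by simp [c]⟩
  | succ n ih =>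
    obtain ⟨hc, hd⟩ := hF
    choose g hg hg' using fun a => ih (hd a).2
    refine ⟨fun x => ⟨fun k => F (x, k), by fun_prop⟩, ?_, fun x k => rfl⟩
    push_cast
    refine contDiff_succ_of_pointwise_lineDeriv hg fun h x k => ?_
    have h1 := ((hd h).1 (x, (k : E))).hasLineDerivAt
    rw [hg']
    unfold HasLineDerivAt at h1 ⊢
    simpa using h1

theorem ContDiffFst.isCFst {n : ℕ} {F : V × E → ℝ} (hF : ContDiffFst n F) : IsCFst n F := by
  induction n generalizing F with
  | zero => exact hF.continuous
  | succ n ih =>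
    refine ⟨hF.continuous, fun a => ?_⟩
    obtain ⟨D, hD, hD'⟩ := hF.exists_lineDeriv a
    refine ⟨fun p => (hD' p).lineDifferentiableAt, ?_⟩
    have : (fun p => lineDeriv ℝ F p (a, 0)) = D := funext fun p => (hD' p).lineDeriv
    rw [this]
    exact ih hD

end FirstVariable

/-! ### Transfer from the diagonal, for functions with a parameter in `E` -/

section Matrices

attribute [local instance] Matrix.linftyOpNormedRing Matrix.linftyOpNormedAlgebra
attribute [local instance] matrixNormTopology

theorem contDiffFst_of_diagonal {ι : Type} [Fintype ι] [DecidableEq ι] {E : Type*}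
    [NormedAddCommGroup E] [ProperSpace E] {n : ℕ} {F : Matrix ι ι ℝ × E → ℝ}
    (hF : ∀ x y v, OrthRel x y → F (x, v) = F (y, v))
    (hf : ContDiffFst n fun p : (ι → ℝ) × E => F (Matrix.diagonal p.1, p.2)) :
    ContDiffFst n F := by
  intro R
  obtain ⟨w, hw, hw'⟩ := hf R
  choose ρ hρ using exists_orthRel_diagonal (ι := ι)
  have hu : ∀ x k, w (ρ x) k = F (x, k) := fun x k => by rw [hw', hF _ _ _ (hρ x)]
  refine ⟨fun x => w (ρ x), inheritsRegularity_diagonal ι _ n _ (fun x y h => ?_) ?_, hu⟩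
  · ext k; rw [hu, hu, hF _ _ _ h]
  · have : (fun x => w (ρ x)) ∘ Matrix.diagonal = w := by
      funext δ; ext k; rw [Function.comp_apply, hu, hw']
    rw [this]; exact hw

theorem isCFst_of_diagonal {ι : Type} [Fintype ι] [DecidableEq ι] {E V : Type*}
    [NormedAddCommGroup E] [NormedSpace ℝ E] [ProperSpace E] [AddCommGroup V] [Module ℝ V]
    [TopologicalSpace V] [IsTopologicalAddGroup V] [ContinuousSMul ℝ V] [T2Space V]
    [FiniteDimensional ℝ V] {n : ℕ} {F : Matrix ι ι ℝ × E → ℝ}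
    (hF : ∀ x y v, OrthRel x y → F (x, v) = F (y, v))
    (hf : IsCFst n fun p : (ι → ℝ) × E => F (Matrix.diagonal p.1, p.2))
    (L : V →ₗ[ℝ] Matrix ι ι ℝ) : IsCFst n fun p : V × E => F (L p.1, p.2) :=
  (contDiffFst_of_diagonal hF hf.contDiffFst).isCFst.comp_fst L L.continuous_of_finiteDimensional

end Matrices

/-! ### From orthogonal to rotation invariance, and induction on `N` -/

section Rotations

variable {d : ℕ}

/-- If `det U = -1`, then `U` is multiplied on the right by the reflection in an eigenvector of `x`,
which commutes with `x`. -/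
theorem exists_rotation_of_orthogonal {x y U : Matrix (Fin d) (Fin d) ℝ} (hx : x.transpose = x)
    (hU : U ∈ Matrix.orthogonalGroup (Fin d) ℝ) (hy : y = U * x * U.transpose) :
    ∃ g ∈ Matrix.specialOrthogonalGroup (Fin d) ℝ, y = g * x * g⁻¹ := by
  have hinv : ∀ {g : Matrix (Fin d) (Fin d) ℝ}, g ∈ Matrix.orthogonalGroup (Fin d) ℝ →
      g⁻¹ = g.transpose := fun hg => Matrix.inv_eq_right_inv (mul_transpose_of_mem hg)
  have hdet : ∀ {g : Matrix (Fin d) (Fin d) ℝ}, g ∈ Matrix.orthogonalGroup (Fin d) ℝ →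
      g.det * g.det = 1 := fun hg => by
    have := congrArg Matrix.det (mul_transpose_of_mem hg)
    rwa [Matrix.det_mul, Matrix.det_transpose, Matrix.det_one] at this
  rcases mul_self_eq_one_iff.1 (hdet hU) with h | h
  · exact ⟨U, Matrix.mem_specialOrthogonalGroup_iff.2 ⟨hU, h⟩, by rw [hinv hU, hy]⟩
  obtain rfl | hd := Nat.eq_zero_or_pos d
  · norm_num at h
  obtain ⟨W, hW, δ, rfl⟩ := exists_orthogonal_diagonal hx
  let s : Fin d → ℝ := Function.update 1 ⟨0, hd⟩ (-1)
  have hs : ∀ i, s i * s i = 1 := fun i => by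
    by_cases hi : i = ⟨0, hd⟩
    · simp [s, hi]
    · simp [s, hi]
  have hsp : ∏ i, s i = -1 := by
    simp [s, Finset.prod_update_of_mem]
  have hsm : Matrix.diagonal s ∈ Matrix.orthogonalGroup (Fin d) ℝ := by
    rw [Matrix.mem_orthogonalGroup_iff, Matrix.diagonal_transpose, Matrix.diagonal_mul_diagonal]
    simp [hs]
  have hg : U * (W * Matrix.diagonal s * W.transpose) ∈ Matrix.orthogonalGroup (Fin d) ℝ :=
    mul_mem hU (mul_mem (mul_mem hW hsm) (transpose_mem hW))
  refine ⟨_, Matrix.mem_specialOrthogonalGroup_iff.2 ⟨hg, ?_⟩, ?_⟩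
  · rw [Matrix.det_mul, Matrix.det_mul, Matrix.det_mul, Matrix.det_transpose, Matrix.det_diagonal,
      h, hsp]
    linear_combination hdet hW
  · have h1 : Matrix.diagonal s * (Matrix.diagonal δ * Matrix.diagonal s) =
        Matrix.diagonal δ := by
      rw [Matrix.diagonal_mul_diagonal, Matrix.diagonal_mul_diagonal]
      congr 1; funext i
      linear_combination δ i * hs i
    have h2 : ∀ z : Matrix (Fin d) (Fin d) ℝ, W.transpose * (W * z) = z := fun z => by
      rw [← Matrix.mul_assoc, transpose_mul_of_mem hW, Matrix.one_mul]
    rw [hinv hg, hy]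
    simp only [Matrix.transpose_mul, Matrix.transpose_transpose, Matrix.diagonal_transpose,
      Matrix.mul_assoc, h2]
    congr 2
    rw [← Matrix.mul_assoc (Matrix.diagonal δ) (Matrix.diagonal s),
      ← Matrix.mul_assoc (Matrix.diagonal s) (Matrix.diagonal δ * Matrix.diagonal s), h1]

variable {E : Type*} {W V : Submodule ℝ (Matrix (Fin d) (Fin d) ℝ)}

theorem RotationInvariant.eq_of_orthRel {F : V × E → ℝ} (hF : RotationInvariant V F)
    (hV : ∀ x ∈ V, x.transpose = x) {x y : V}
    (h : OrthRel (x : Matrix (Fin d) (Fin d) ℝ) y) (v : E) : F (x, v) = F (y, v) := by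
  obtain ⟨U, hU, h⟩ := h
  rw [symPart_of_isSymm (hV _ x.2), symPart_of_isSymm (hV _ y.2)] at h
  obtain ⟨g, hg, hgy⟩ := exists_rotation_of_orthogonal (hV _ x.2) hU h
  exact (hF g hg x y hgy v).symm

variable [NormedAddCommGroup E] [InnerProductSpace ℝ E] [FiniteDimensional ℝ E]

/-- The regularity of rotation-invariant functions on a space `V` of symmetric matrices, where `V`
is the image of an equivariant projection that maps diagonal matrices to `W`. -/
theorem isCnN_of_restrictFst (hWV : W ≤ V) (hV : ∀ x ∈ V, x.transpose = x)
    (q : Matrix (Fin d) (Fin d) ℝ →ₗ[ℝ] Matrix (Fin d) (Fin d) ℝ) (hq : ∀ x, q x ∈ V)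
    (hqV : ∀ x ∈ V, q x = x) (hqr : ∀ x y, OrthRel x y → OrthRel (q x) (q y))
    (hqd : ∀ δ, q (Matrix.diagonal δ) ∈ W) {n N : ℕ} {F : V × E → ℝ}
    (hF : RotationInvariant V F) (hf : IsCnN n N (restrictFst hWV F)) : IsCnN n N F := by
  -- The case `N = 0`: pulling `G` back along `q` gives an orthogonally invariant function on all
  -- matrices.
  have hfst : ∀ G : V × E → ℝ, RotationInvariant V G → IsCFst n (restrictFst hWV G) →
      IsCFst n G := by
    intro G hG hg
    let L : (Fin d → ℝ) →ₗ[ℝ] W :=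
      { toFun := fun δ => ⟨q (Matrix.diagonal δ), hqd δ⟩
        map_add' := fun a b => Subtype.ext (by
          show q (Matrix.diagonal (a + b)) = q (Matrix.diagonal a) + q (Matrix.diagonal b)
          rw [← map_add, Matrix.diagonal_add]; rfl)
        map_smul' := fun c a => Subtype.ext (by
          show q (Matrix.diagonal (c • a)) = c • q (Matrix.diagonal a)
          rw [← map_smul, Matrix.diagonal_smul]) }
    have hL : Continuous L := L.continuous_of_finiteDimensional
    have h1 : IsCFst n fun p : (Fin d → ℝ) × E => G (⟨q (Matrix.diagonal p.1), hq _⟩, p.2) :=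
      hg.comp_fst L hL
    have hinv : ∀ (x y : Matrix (Fin d) (Fin d) ℝ) (v : E), OrthRel x y →
        G (⟨q x, hq x⟩, v) = G (⟨q y, hq y⟩, v) := fun x y v h =>
      hG.eq_of_orthRel hV (x := ⟨q x, hq x⟩) (y := ⟨q y, hq y⟩) (hqr x y h) v
    have h2 := isCFst_of_diagonal (V := V)
      (F := fun p : Matrix (Fin d) (Fin d) ℝ × E => G (⟨q p.1, hq p.1⟩, p.2)) hinv h1 V.subtype
    have h3 : (fun p : V × E => G (⟨q (V.subtype p.1), hq _⟩, p.2)) = G := by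
      funext p
      congr 2
      exact Subtype.ext (hqV _ p.1.2)
    rwa [h3] at h2
  induction N generalizing F with
  | zero => exact hfst F hF hf
  | succ N ih =>
    obtain ⟨h1, h2⟩ := hf
    have key : ∀ (b : E) (p : W × E) (t : ℝ), restrictFst hWV F (p + t • (0, b)) =
        F ((Submodule.inclusion hWV p.1, p.2) + t • (0, b)) := fun b p t => by simp [restrictFst]
    refine ⟨hfst F hF h1, fun b => ⟨fun p => ?_, ih (fun g hg x y hxy v => ?_) ?_⟩⟩
    -- Along `E` the function at `x` coincides with that at a conjugate point of `W`, where the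
    -- derivative exists.
    · obtain ⟨x, v⟩ := p
      obtain ⟨δ, hδ⟩ := exists_orthRel_diagonal (x : Matrix (Fin d) (Fin d) ℝ)
      have h3 := hqr _ _ hδ
      rw [hqV _ x.2] at h3
      have h4 := (h2 b).1 (⟨_, hqd δ⟩, v)
      unfold LineDifferentiableAt at h4 ⊢
      simp only [key] at h4
      refine h4.congr_of_eventuallyEq (Eventually.of_forall fun t => ?_)
      have h5 := hF.eq_of_orthRel hV (x := x) (y := Submodule.inclusion hWV ⟨_, hqd δ⟩) h3
        (v + t • b)
      simpa using h5
    · unfold lineDeriv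
      simp [hF g hg x y hxy]
    · have h3 := (h2 b).2
      have h4 : restrictFst hWV (fun p => lineDeriv ℝ F p (0, b)) =
          fun p => lineDeriv ℝ (restrictFst hWV F) p (0, b) := by
        funext p
        unfold lineDeriv
        simp only [key]
        rfl
      rw [h4]
      exact h3

end Rotations

end MatrixFunctions

theorem theorem3 (d n N : ℕ) {E : Type*} [NormedAddCommGroup E] [InnerProductSpace ℝ E]
    [FiniteDimensional ℝ E] :
    (∀ F : MatrixFunctions.symmMat d × E → ℝ,
      MatrixFunctions.RotationInvariant (MatrixFunctions.symmMat d) F →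
      MatrixFunctions.IsCnN n N
        (MatrixFunctions.restrictFst (MatrixFunctions.diagMat_le_symmMat d) F) →
      MatrixFunctions.IsCnN n N F) ∧
    (∀ F : MatrixFunctions.symmMat₀ d × E → ℝ,
      MatrixFunctions.RotationInvariant (MatrixFunctions.symmMat₀ d) F →
      MatrixFunctions.IsCnN n N
        (MatrixFunctions.restrictFst (MatrixFunctions.diagMat₀_le_symmMat₀ d) F) →
      MatrixFunctions.IsCnN n N F) := by
  open MatrixFunctions in
  refine ⟨fun F hF hf => ?_, fun F hF hf => ?_⟩
  · refine isCnN_of_restrictFst (diagMat_le_symmMat d) (fun x hx => hx) symPart.toLinearMap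
      symPart_transpose (fun x hx => symPart_of_isSymm hx) (fun x y h => ?_) (fun δ => ?_) hF hf
    · obtain ⟨U, hU, h⟩ := h
      exact ⟨U, hU, by simpa only [ContinuousLinearMap.coe_coe, symPart_symPart] using h⟩
    · rw [ContinuousLinearMap.coe_coe, symPart_diagonal]
      exact Matrix.isDiag_diagonal δ
  · have hmem : ∀ x, tracelessPart x ∈ symmMat₀ d := fun x => by
      refine ⟨?_, trace_tracelessPart x⟩
      have := symPart_transpose (tracelessPart x)
      rwa [symPart_tracelessPart] at this
    refine isCnN_of_restrictFst (diagMat₀_le_symmMat₀ d) (fun x hx => hx.1) tracelessPart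
      hmem (fun x hx => ?_) (fun x y h => h.tracelessPart) (fun δ => ⟨?_, hmem _⟩) hF hf
    · have htr : x.trace = 0 := hx.2
      rw [tracelessPart_apply, symPart_of_isSymm hx.1, htr]
      simp
    · rw [tracelessPart_diagonal]
      exact Matrix.isDiag_diagonal _
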